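/- Work in many-sorted, relational $[0,1]$-valued continuous logic: a metric signature $\mathcal L$ has sorts and predicate symbols, each predicate symbol with a finite string of input sorts and a modulus of uniform continuity (a continuous function $[0,1]\to[0,1]$ vanishing at $0$); in an $\mathcal L$-structure every sort is a nonempty complete metric space of diameter at most $1$ and every predicate symbol is interpreted by a $[0,1]$-valued function obeying its modulus. Restricted formulas are built from predicate symbols and the metrics with the connectives $0$, $1$, $x/2$, $x\mathbin{\dot-}y$ and the quantifiers $\sup$, $\inf$; a formula is an expression $\sum_{n<\omega}2^{-(n+1)}\varphi_n$ with restricted formulas $\varphi_n$ whose free variables all lie in one finite list. Given a class $C$ of $\mathcal L$-structures, a uniform imaginary expansion of $C$ is obtained by finitely many steps, each of which appends to all structures of the class, by means of the same sorts and formulas, one of the following new sorts: a finite nonempty product of sorts (with the maximum metric) or an $\omega$-product $\prod_{i<\omega}O_i$ (with the metric $\sup_{i}2^{-i}d_{O_i}$), together with the predicates $\pi_i(x,y)=d(x_i,y)$; a nonempty closed set whose distance predicate is given, in every structure of the class, by a formula without parameters, together with the inclusion predicate $\iota(x,y)=d(x,y)$; or the quotient $O/\rho$ (completed, if necessary) by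 a pseudo-metric $\rho$ given, in every structure of the class, by a formula without parameters, together with the predicate $q$ on $O\times O/\rho$ giving the distance from the class of the first argument to the second, so that $q(x,[y]_\rho)=\rho(x,y)$. A uniformly definable imaginary of $C$ is a sort of a uniform imaginary expansion of $C$. **Lemma.** Let $\mathcal L$ be a metric signature with a designated sort $H$, let $0<r\le 1$, and let $C_{\mathcal L,r}$ be the class of $\mathcal L$-structures $\mathfrak A$ with $\operatorname{diam}(H^{\mathfrak A})\ge r$. Let $X$ be a nonempty compact metric space of diameter at most $1$. Then there are a uniform imaginary expansion of $C_{\mathcal L,r}$, with signature $\mathcal L'$ and expanded structures $\mathfrak A'$, a sort $Y$ of it, and surjective isometries $e_{\mathfrak A}:X\to Y^{\mathfrak A'}$ for all $\mathfrak A\in C_{\mathcal L,r}$, such that: 1. for each $p\in X$ there is one $\mathcal L'$-formula $\varphi(y)$ with $\varphi^{\mathfrak A'}(y)=d(y,e_{\mathfrak A}(p))$ for all $\mathfrak A\in C_{\mathcal L,r}$ and all $y\in Y^{\mathfrak A'}$; 2. for each $n<\omega$ and each continuous $f:X^n\to[0,1]$ there is one $\mathcal L'$-formula $\varphi(y_1,\dots,y_n)$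 with $\varphi^{\mathfrak A'}(y_1,\dots,y_n)=f(e_{\mathfrak A}^{-1}(y_1),\dots,e_{\mathfrak A}^{-1}(y_n))$ for all $\mathfrak A\in C_{\mathcal L,r}$ and all $y_1,\dots,y_n\in Y^{\mathfrak A'}$. -/

import Mathlib

universe u v w k x

namespace ContLogic

open Set UniformSpace

noncomputable section

/-! ### Moduli of uniform continuity -/

/-- A modulus of uniform continuity: a continuous function `[0,1] → [0,1]` vanishing at `0`. -/
structure Modulus where
  toFun : unitInterval → unitInterval
  continuous_toFun : Continuous toFun
  map_zero : toFun 0 = 0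

/-- The truncation of a real number to `[0,1]`. -/
def clamp (x : ℝ) : unitInterval := projIcc 0 1 zero_le_one x

theorem coe_clamp_of_mem {x : ℝ} (h : x ∈ Icc (0 : ℝ) 1) : (clamp x : ℝ) = x := by
  simp [clamp, projIcc_of_mem _ h]

theorem le_clamp {x y : ℝ} (h : x ≤ 1) (hxy : x ≤ y) : x ≤ (clamp y : ℝ) := by
  simp only [clamp, coe_projIcc]
  exact le_max_of_le_right (le_min h hxy)

namespace Modulus

/-- The modulus `t ↦ min (f t) 1` (truncated to `[0,1]`) given by a continuous real function. -/
def ofReal (f : unitInterval → ℝ) (hf : Continuous f) (h0 : f 0 = 0) : Modulus where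
  toFun t := clamp (f t)
  continuous_toFun := continuous_projIcc.comp hf
  map_zero := by
    apply Subtype.ext
    rw [h0, coe_clamp_of_mem (by simp)]
    rfl

/-- The function `t ↦ min (c * t) 1`. -/
def linear (c : ℝ) : Modulus :=
  ofReal (fun t => c * (t : ℝ)) (by fun_prop) (by simp)

/-- The least nondecreasing function above a modulus, `t ↦ sup {Δ s | s ≤ t}`. It is `Δ` itself
if `Δ` is nondecreasing. -/
def runningMax (Δ : Modulus) : unitInterval → ℝ :=
  fun t => sSup ((fun s : unitInterval => (Δ.toFun (s * t) : ℝ)) '' univ)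

end Modulus

/-! ### Signatures and structures -/

/-- A (many-sorted, relational) metric signature: sorts, predicate symbols, the finite string of
input sorts of each predicate symbol, and the syntactic modulus of each predicate symbol. -/
structure MetricSignature where
  Srt : Type u
  Pred : Type v
  arity : Pred → ℕ
  dom : (P : Pred) → Fin (arity P) → Srt
  modulus : Pred → Modulus

/-- A structure for a metric signature: each sort is a nonempty complete metric space of diameter
at most `1`, each predicate symbol is a `[0,1]`-valued function obeying its modulus with respect to
the maximum metric on tuples (`dist a b` below is the maximum of the `dist (a i) (b i)`). -/
structure MetricStructure (L : MetricSignature.{u, v}) where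
  carrier : L.Srt → Type w
  metric : ∀ s, MetricSpace (carrier s)
  complete : ∀ s, CompleteSpace (carrier s)
  nonempty : ∀ s, Nonempty (carrier s)
  dist_le_one : ∀ s (x y : carrier s), dist x y ≤ 1
  interp : (P : L.Pred) → ((i : Fin (L.arity P)) → carrier (L.dom P i)) → ℝ
  interp_mem : ∀ P a, interp P a ∈ Icc (0 : ℝ) 1
  interp_modulus : ∀ P a b,
    |interp P a - interp P b| ≤ ((L.modulus P).toFun (clamp (dist a b)) : ℝ)

attribute [instance] MetricStructure.metric MetricStructure.complete MetricStructure.nonempty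

/-! ### Formulas -/

/-- Restricted formulas. `Γ : Fin n → L.Srt` lists the sorts of the free variables, which are
numbered by `Fin n`; a quantifier binds the variable number `0` of the longer context. Atomic
formulas are predicate symbols and metrics applied to variables, the connectives are `0`, `1`,
`x / 2` and truncated subtraction. -/
inductive RFormula (L : MetricSignature.{u, v}) : {n : ℕ} → (Fin n → L.Srt) → Type (max u v)
  | rel {n : ℕ} {Γ : Fin n → L.Srt} (P : L.Pred) (x : Fin (L.arity P) → Fin n)
      (h : ∀ i, Γ (x i) = L.dom P i) : RFormula L Γ
  | metric {n : ℕ} {Γ : Fin n → L.Srt} (x y : Fin n) (h : Γ y = Γ x) : RFormula L Γ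
  | zero {n : ℕ} {Γ : Fin n → L.Srt} : RFormula L Γ
  | one {n : ℕ} {Γ : Fin n → L.Srt} : RFormula L Γ
  | half {n : ℕ} {Γ : Fin n → L.Srt} (φ : RFormula L Γ) : RFormula L Γ
  | tsub {n : ℕ} {Γ : Fin n → L.Srt} (φ ψ : RFormula L Γ) : RFormula L Γ
  | sup {n : ℕ} {Γ : Fin n → L.Srt} (s : L.Srt)
      (φ : RFormula L (Fin.cons s Γ : Fin (n + 1) → L.Srt)) : RFormula L Γ
  | inf {n : ℕ} {Γ : Fin n → L.Srt} (s : L.Srt)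
      (φ : RFormula L (Fin.cons s Γ : Fin (n + 1) → L.Srt)) : RFormula L Γ

variable {L : MetricSignature.{u, v}}

/-- Assignments of values to the variables of the context `Γ`. -/
abbrev Assignment (A : MetricStructure.{u, v, w} L) {n : ℕ} (Γ : Fin n → L.Srt) : Type w :=
  (i : Fin n) → A.carrier (Γ i)

/-- Add a value for a new variable number `0`. -/
def Assignment.cons {A : MetricStructure.{u, v, w} L} {n : ℕ} {Γ : Fin n → L.Srt} {s : L.Srt}
    (x : A.carrier s) (a : Assignment A Γ) :
    Assignment A (Fin.cons s Γ : Fin (n + 1) → L.Srt) :=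
  Fin.cons (α := fun i => A.carrier ((Fin.cons s Γ : Fin (n + 1) → L.Srt) i)) x a

/-- The value of a restricted formula in a structure. -/
def RFormula.eval (A : MetricStructure.{u, v, w} L) :
    {n : ℕ} → {Γ : Fin n → L.Srt} → RFormula L Γ → Assignment A Γ → ℝ
  | _, _, .rel P x h, a => A.interp P (fun i => (h i) ▸ a (x i))
  | _, _, .metric x y h, a => dist (a x) (h ▸ a y)
  | _, _, .zero, _ => 0
  | _, _, .one, _ => 1
  | _, _, .half φ, a => φ.eval A a / 2
  | _, _, .tsub φ ψ, a => max (φ.eval A a - ψ.eval A a) 0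
  | _, _, .sup s φ, a => ⨆ x : A.carrier s, φ.eval A (Assignment.cons x a)
  | _, _, .inf s φ, a => ⨅ x : A.carrier s, φ.eval A (Assignment.cons x a)

/-- A syntactic modulus (real-valued, not yet truncated to `[0,1]`) of a restricted formula. -/
def RFormula.rawModulus : {n : ℕ} → {Γ : Fin n → L.Srt} → RFormula L Γ → unitInterval → ℝ
  | _, _, .rel P _ _ => (L.modulus P).runningMax
  | _, _, .metric _ _ _ => fun t => 2 * (t : ℝ)
  | _, _, .zero => fun _ => 0
  | _, _, .one => fun _ => 0
  | _, _, .half φ => fun t => φ.rawModulus t / 2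
  | _, _, .tsub φ ψ => fun t => φ.rawModulus t + ψ.rawModulus t
  | _, _, .sup _ φ => φ.rawModulus
  | _, _, .inf _ φ => φ.rawModulus

/-- A (finitary) formula with free variables in the context `Γ`: the formal sum
`∑ 2 ^ (-(n + 1)) φ_n` of a sequence of restricted formulas. -/
structure Formula (L : MetricSignature.{u, v}) {n : ℕ} (Γ : Fin n → L.Srt) where
  seq : ℕ → RFormula L Γ

/-- The value of a formula in a structure. -/
def Formula.eval {n : ℕ} {Γ : Fin n → L.Srt} (φ : Formula L Γ)
    (A : MetricStructure.{u, v, w} L) (a : Assignment A Γ) : ℝ :=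
  ∑' m : ℕ, (1 / 2 : ℝ) ^ (m + 1) * (φ.seq m).eval A a

/-! ### Basic facts on formulas -/

theorem Modulus.runningMax_continuous (Δ : Modulus) : Continuous Δ.runningMax := by
  refine IsCompact.continuous_sSup isCompact_univ ?_
  have := Δ.continuous_toFun
  fun_prop

theorem Modulus.runningMax_zero (Δ : Modulus) : Δ.runningMax 0 = 0 := by
  simp [runningMax, Δ.map_zero]

theorem Modulus.le_runningMax (Δ : Modulus) {s t : unitInterval} (h : s ≤ t) :
    (Δ.toFun s : ℝ) ≤ Δ.runningMax t := by
  refine le_csSup ⟨1, ?_⟩ ?_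
  · rintro _ ⟨x, -, rfl⟩
    exact (Δ.toFun _).2.2
  · rcases eq_or_lt_of_le t.2.1 with h0 | h0
    · refine ⟨0, trivial, ?_⟩
      have ht : s = 0 := le_antisymm (h.trans (le_of_eq (Subtype.ext h0.symm))) s.2.1
      simp [ht]
    · refine ⟨⟨s / t, div_nonneg s.2.1 t.2.1, div_le_one_of_le₀ h t.2.1⟩, trivial, ?_⟩
      have : (⟨s / t, div_nonneg s.2.1 t.2.1, div_le_one_of_le₀ h t.2.1⟩ : unitInterval) * t
          = s := by
        apply Subtype.ext
        simp only [Icc.coe_mul]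
        field_simp
      simp [this]

theorem RFormula.rawModulus_continuous {n : ℕ} {Γ : Fin n → L.Srt} (φ : RFormula L Γ) :
    Continuous φ.rawModulus := by
  induction φ with
  | rel P x h => exact Modulus.runningMax_continuous _
  | metric x y h => simp only [rawModulus]; fun_prop
  | zero => simp only [rawModulus]; fun_prop
  | one => simp only [rawModulus]; fun_prop
  | half φ ih => simp only [rawModulus]; fun_prop
  | tsub φ ψ ih1 ih2 => simp only [rawModulus]; fun_prop
  | sup s φ ih => exact ih
  | inf s φ ih => exact ih

theorem RFormula.rawModulus_zero {n : ℕ} {Γ : Fin n → L.Srt} (φ : RFormula L Γ) :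
    φ.rawModulus 0 = 0 := by
  induction φ with
  | rel P x h => exact Modulus.runningMax_zero _
  | metric x y h => simp [rawModulus]
  | zero => simp [rawModulus]
  | one => simp [rawModulus]
  | half φ ih => simp [rawModulus, ih]
  | tsub φ ψ ih1 ih2 => simp [rawModulus, ih1, ih2]
  | sup s φ ih => exact ih
  | inf s φ ih => exact ih

/-- The syntactic modulus of a restricted formula. -/
def RFormula.modulus {n : ℕ} {Γ : Fin n → L.Srt} (φ : RFormula L Γ) : Modulus :=
  Modulus.ofReal φ.rawModulus φ.rawModulus_continuous φ.rawModulus_zero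

/-- The syntactic modulus of a formula, `∑ 2 ^ (-(n + 1)) Δ_{φ_n}`. -/
def Formula.rawModulus {n : ℕ} {Γ : Fin n → L.Srt} (φ : Formula L Γ) (t : unitInterval) : ℝ :=
  ∑' m : ℕ, (1 / 2 : ℝ) ^ (m + 1) * ((φ.seq m).modulus.toFun t : ℝ)

theorem summable_half_pow_succ : Summable fun m : ℕ => (1 / 2 : ℝ) ^ (m + 1) :=
  (summable_nat_add_iff 1).2 summable_geometric_two

theorem tsum_half_pow_succ : ∑' m : ℕ, (1 / 2 : ℝ) ^ (m + 1) = 1 := by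
  simp only [pow_succ, tsum_mul_right, tsum_geometric_two]
  norm_num

theorem summable_half_pow_mul {c : ℕ → ℝ} (hc : ∀ m, c m ∈ Icc (0 : ℝ) 1) :
    Summable fun m : ℕ => (1 / 2 : ℝ) ^ (m + 1) * c m :=
  Summable.of_nonneg_of_le (fun m => mul_nonneg (by positivity) (hc m).1)
    (fun m => mul_le_of_le_one_right (by positivity) (hc m).2) summable_half_pow_succ

theorem Formula.rawModulus_continuous {n : ℕ} {Γ : Fin n → L.Srt} (φ : Formula L Γ) :
    Continuous φ.rawModulus := by
  refine continuous_tsum (fun m => ?_) summable_half_pow_succ (fun m t => ?_)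
  · exact continuous_const.mul
      (continuous_subtype_val.comp (φ.seq m).modulus.continuous_toFun)
  · rw [Real.norm_of_nonneg (mul_nonneg (by positivity) ((φ.seq m).modulus.toFun t).2.1)]
    exact mul_le_of_le_one_right (by positivity) ((φ.seq m).modulus.toFun t).2.2

theorem Formula.rawModulus_zero {n : ℕ} {Γ : Fin n → L.Srt} (φ : Formula L Γ) :
    φ.rawModulus 0 = 0 := by
  simp [rawModulus, Modulus.map_zero]

theorem RFormula.eval_mem (A : MetricStructure.{u, v, w} L) {n : ℕ} {Γ : Fin n → L.Srt}
    (φ : RFormula L Γ) (a : Assignment A Γ) : φ.eval A a ∈ Icc (0 : ℝ) 1 := by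
  induction φ with
  | rel P x h => exact A.interp_mem _ _
  | metric x y h => exact ⟨dist_nonneg, A.dist_le_one _ _ _⟩
  | zero => simp [eval]
  | one => simp [eval]
  | half φ ih =>
    have := ih a
    simp only [eval, mem_Icc] at *
    constructor <;> linarith
  | tsub φ ψ ih1 ih2 =>
    have h1 := ih1 a
    have h2 := ih2 a
    simp only [eval, mem_Icc] at *
    exact ⟨le_max_right _ _, max_le (by linarith) zero_le_one⟩
  | sup s φ ih =>
    refine ⟨Real.iSup_nonneg fun x => (ih _).1, ?_⟩
    exact ciSup_le fun x => (ih _).2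
  | inf s φ ih =>
    refine ⟨Real.iInf_nonneg fun x => (ih _).1, ?_⟩
    exact (ciInf_le ⟨0, by rintro _ ⟨x, rfl⟩; exact (ih _).1⟩ (Classical.arbitrary _)).trans
      (ih _).2

theorem dist_transport (A : MetricStructure.{u, v, w} L) {s t : L.Srt} (h : s = t)
    (x y : A.carrier s) : dist (h ▸ x : A.carrier t) (h ▸ y) = dist x y := by
  subst h; rfl

theorem abs_ciSup_sub_le {ι : Type*} [Nonempty ι] {f g : ι → ℝ} {c : ℝ}
    (hf : BddAbove (range f)) (hg : BddAbove (range g)) (h : ∀ i, |f i - g i| ≤ c) :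
    |(⨆ i, f i) - ⨆ i, g i| ≤ c := by
  rw [abs_le]
  constructor
  · have : ⨆ i, g i ≤ (⨆ i, f i) + c := ciSup_le fun i => by
      have := (abs_le.1 (h i)).1
      have := le_ciSup hf i
      linarith
    linarith
  · have : ⨆ i, f i ≤ (⨆ i, g i) + c := ciSup_le fun i => by
      have := (abs_le.1 (h i)).2
      have := le_ciSup hg i
      linarith
    linarith

theorem abs_ciInf_sub_le {ι : Type*} [Nonempty ι] {f g : ι → ℝ} {c : ℝ}
    (hf : BddBelow (range f)) (hg : BddBelow (range g)) (h : ∀ i, |f i - g i| ≤ c) :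
    |(⨅ i, f i) - ⨅ i, g i| ≤ c := by
  rw [abs_le]
  constructor
  · have : (⨅ i, g i) - c ≤ ⨅ i, f i := le_ciInf fun i => by
      have := (abs_le.1 (h i)).1
      have := ciInf_le hg i
      linarith
    linarith
  · have : (⨅ i, f i) - c ≤ ⨅ i, g i := le_ciInf fun i => by
      have := (abs_le.1 (h i)).2
      have := ciInf_le hf i
      linarith
    linarith

theorem RFormula.abs_eval_sub_le (A : MetricStructure.{u, v, w} L) {n : ℕ} {Γ : Fin n → L.Srt}
    (φ : RFormula L Γ) (t : unitInterval) (a b : Assignment A Γ)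
    (hab : ∀ i, dist (a i) (b i) ≤ t) : |φ.eval A a - φ.eval A b| ≤ φ.rawModulus t := by
  induction φ with
  | rel P x h =>
    refine (A.interp_modulus _ _ _).trans (Modulus.le_runningMax _ ?_)
    have hd : dist (fun i => (h i) ▸ a (x i) : (i : Fin (L.arity P)) → A.carrier (L.dom P i))
        (fun i => (h i) ▸ b (x i)) ≤ t :=
      (dist_pi_le_iff t.2.1).2 fun i => (dist_transport A (h i) _ _).trans_le (hab _)
    refine Subtype.coe_le_coe.1 ?_
    rw [coe_clamp_of_mem ⟨dist_nonneg, hd.trans t.2.2⟩]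
    exact hd
  | metric x y h =>
    simp only [eval, rawModulus]
    have h1 := hab x
    have h2 := (dist_transport A h (a y) (b y)).trans_le (hab y)
    have h3 := dist_dist_dist_le (a x) (h ▸ a y) (b x) (h ▸ b y)
    rw [Real.dist_eq] at h3
    linarith
  | zero => simp [eval, rawModulus]
  | one => simp [eval, rawModulus]
  | half φ ih =>
    have := ih a b hab
    simp only [eval, rawModulus]
    rw [← sub_div, abs_div, abs_two]
    linarith
  | tsub φ ψ ih1 ih2 =>
    have h1 := ih1 a b hab
    have h2 := ih2 a b hab
    simp only [eval, rawModulus]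
    refine (abs_max_sub_max_le_abs _ _ _).trans ?_
    rw [sub_sub_sub_comm]
    exact (abs_sub _ _).trans (add_le_add h1 h2)
  | sup s φ ih =>
    refine abs_ciSup_sub_le ⟨1, ?_⟩ ⟨1, ?_⟩ fun x => ih _ _ ?_
    · rintro _ ⟨x, rfl⟩; exact (φ.eval_mem A _).2
    · rintro _ ⟨x, rfl⟩; exact (φ.eval_mem A _).2
    · intro i
      refine Fin.cases ?_ (fun j => hab j) i
      exact (dist_self x).trans_le t.2.1
  | inf s φ ih =>
    refine abs_ciInf_sub_le ⟨0, ?_⟩ ⟨0, ?_⟩ fun x => ih _ _ ?_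
    · rintro _ ⟨x, rfl⟩; exact (φ.eval_mem A _).1
    · rintro _ ⟨x, rfl⟩; exact (φ.eval_mem A _).1
    · intro i
      refine Fin.cases ?_ (fun j => hab j) i
      exact (dist_self x).trans_le t.2.1

theorem Formula.eval_mem {n : ℕ} {Γ : Fin n → L.Srt} (φ : Formula L Γ)
    (A : MetricStructure.{u, v, w} L) (a : Assignment A Γ) : φ.eval A a ∈ Icc (0 : ℝ) 1 := by
  have h := fun m => (φ.seq m).eval_mem A a
  refine ⟨tsum_nonneg fun m => mul_nonneg (by positivity) (h m).1, ?_⟩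
  refine ((summable_half_pow_mul h).tsum_le_tsum
    (fun m => mul_le_of_le_one_right (by positivity) (h m).2) summable_half_pow_succ).trans ?_
  exact tsum_half_pow_succ.le

theorem Formula.abs_eval_sub_le {n : ℕ} {Γ : Fin n → L.Srt} (φ : Formula L Γ)
    (A : MetricStructure.{u, v, w} L) (t : unitInterval) (a b : Assignment A Γ)
    (hab : ∀ i, dist (a i) (b i) ≤ t) : |φ.eval A a - φ.eval A b| ≤ φ.rawModulus t := by
  have ha := summable_half_pow_mul fun m => (φ.seq m).eval_mem A a
  have hb := summable_half_pow_mul fun m => (φ.seq m).eval_mem A b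
  have hm := summable_half_pow_mul fun m => ((φ.seq m).modulus.toFun t).2
  have key : ∀ m, |(φ.seq m).eval A a - (φ.seq m).eval A b| ≤
      ((φ.seq m).modulus.toFun t : ℝ) := fun m => by
    refine le_clamp ?_ ((φ.seq m).abs_eval_sub_le A t a b hab)
    have h1 := (φ.seq m).eval_mem A a
    have h2 := (φ.seq m).eval_mem A b
    rw [abs_le]
    constructor <;> linarith [h1.1, h1.2, h2.1, h2.2]
  unfold eval rawModulus
  rw [← ha.tsum_sub hb]
  simp only [← mul_sub]
  have hle : ∀ m : ℕ, |(1 / 2 : ℝ) ^ (m + 1) * ((φ.seq m).eval A a - (φ.seq m).eval A b)| ≤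
      (1 / 2 : ℝ) ^ (m + 1) * ((φ.seq m).modulus.toFun t : ℝ) := fun m => by
    rw [abs_mul, abs_of_nonneg (by positivity : (0 : ℝ) ≤ (1 / 2) ^ (m + 1))]
    exact mul_le_mul_of_nonneg_left (key m) (by positivity)
  exact tsum_of_norm_bounded (f := fun m : ℕ =>
    (1 / 2 : ℝ) ^ (m + 1) * ((φ.seq m).eval A a - (φ.seq m).eval A b)) hm.hasSum hle

/-- The value of a formula with one free variable of sort `s`. -/
def Formula.eval₁ {s : L.Srt} (φ : Formula L ![s]) (A : MetricStructure.{u, v, w} L)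
    (x : A.carrier s) : ℝ :=
  φ.eval A (Fin.cons (α := fun i => A.carrier (![s] i)) x (fun i => i.elim0))

/-- The value of a formula with two free variables of sort `s`. -/
def Formula.eval₂ {s : L.Srt} (φ : Formula L ![s, s]) (A : MetricStructure.{u, v, w} L)
    (x y : A.carrier s) : ℝ :=
  φ.eval A (Fin.cons (α := fun i => A.carrier (![s, s] i)) x
    (Fin.cons (α := fun i => A.carrier (![s] i)) y (fun i => i.elim0)))

theorem Formula.abs_eval₂_sub_le {s : L.Srt} (φ : Formula L ![s, s])
    (A : MetricStructure.{u, v, w} L) (t : unitInterval) (x y x' y' : A.carrier s)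
    (hx : dist x x' ≤ t) (hy : dist y y' ≤ t) :
    |φ.eval₂ A x y - φ.eval₂ A x' y'| ≤ φ.rawModulus t := by
  refine φ.abs_eval_sub_le A t _ _ fun i => ?_
  refine Fin.cases hx (fun j => Fin.cases hy (fun l => l.elim0) j) i

/-! ### The universes of imaginary sorts -/

/-- The universe of an `ω`-product sort. -/
def OmegaProd (Z : ℕ → Type w) : Type w := (i : ℕ) → Z i

/-- The metric `sup_i 2 ^ (-i) d (x i) (y i)` on a countable product. -/
def omegaDist {Z : ℕ → Type w} [∀ i, MetricSpace (Z i)] (x y : OmegaProd Z) : ℝ :=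
  ⨆ i : ℕ, (1 / 2 : ℝ) ^ i * dist (x i) (y i)

theorem omegaDist_bdd {Z : ℕ → Type w} [∀ i, MetricSpace (Z i)]
    (h1 : ∀ i (x y : Z i), dist x y ≤ 1) (x y : OmegaProd Z) (i : ℕ) :
    (1 / 2 : ℝ) ^ i * dist (x i) (y i) ≤ 1 :=
  mul_le_one₀ (pow_le_one₀ (by norm_num) (by norm_num)) dist_nonneg (h1 i _ _)

theorem le_omegaDist {Z : ℕ → Type w} [∀ i, MetricSpace (Z i)]
    (h1 : ∀ i (x y : Z i), dist x y ≤ 1) (x y : OmegaProd Z) (i : ℕ) :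
    (1 / 2 : ℝ) ^ i * dist (x i) (y i) ≤ omegaDist x y :=
  le_ciSup (f := fun i => (1 / 2 : ℝ) ^ i * dist (x i) (y i))
    ⟨1, by rintro _ ⟨j, rfl⟩; exact omegaDist_bdd h1 x y j⟩ i

theorem dist_le_omegaDist {Z : ℕ → Type w} [∀ i, MetricSpace (Z i)]
    (h1 : ∀ i (x y : Z i), dist x y ≤ 1) (x y : OmegaProd Z) (i : ℕ) :
    dist (x i) (y i) ≤ 2 ^ i * omegaDist x y := by
  have h := mul_le_mul_of_nonneg_left (le_omegaDist h1 x y i) (by positivity : (0 : ℝ) ≤ 2 ^ i)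
  rwa [← mul_assoc, ← mul_pow, mul_one_div_cancel two_ne_zero, one_pow, one_mul] at h

/-- The `ω`-product as a metric space. -/
@[reducible] def omegaMetric {Z : ℕ → Type w} [∀ i, MetricSpace (Z i)]
    (h1 : ∀ i (x y : Z i), dist x y ≤ 1) : MetricSpace (OmegaProd Z) where
  dist := omegaDist
  dist_self x := by simp [omegaDist]
  dist_comm x y := by simp [omegaDist, dist_comm]
  dist_triangle x y z := by
    refine ciSup_le fun i => ?_
    have h2 := le_omegaDist h1 x y i
    have h3 := le_omegaDist h1 y z i
    have h4 := mul_le_mul_of_nonneg_left (dist_triangle (x i) (y i) (z i))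
      (by positivity : (0 : ℝ) ≤ (1 / 2) ^ i)
    rw [mul_add] at h4
    linarith
  eq_of_dist_eq_zero := by
    intro x y h
    change omegaDist x y = 0 at h
    funext i
    have h2 := dist_le_omegaDist h1 x y i
    rw [h, mul_zero] at h2
    exact dist_le_zero.1 h2

theorem omega_complete {Z : ℕ → Type w} [∀ i, MetricSpace (Z i)] [∀ i, CompleteSpace (Z i)]
    (h1 : ∀ i (x y : Z i), dist x y ≤ 1) :
    @CompleteSpace (OmegaProd Z) (omegaMetric h1).toUniformSpace := by
  let _ := omegaMetric h1
  refine Metric.complete_of_cauchySeq_tendsto fun f hf => ?_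
  have hc : ∀ i, CauchySeq fun m => f m i := fun i => by
    rw [Metric.cauchySeq_iff] at hf ⊢
    intro ε hε
    obtain ⟨N, hN⟩ := hf (ε / 2 ^ i) (by positivity)
    refine ⟨N, fun m hm l hl => ?_⟩
    have h2 : omegaDist (f m) (f l) < ε / 2 ^ i := hN m hm l hl
    rw [lt_div_iff₀' (by positivity)] at h2
    exact (dist_le_omegaDist h1 _ _ i).trans_lt h2
  choose g hg using fun i => cauchySeq_tendsto_of_complete (hc i)
  refine ⟨(g : OmegaProd Z), Metric.tendsto_atTop.2 ?_⟩
  intro ε hε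
  obtain ⟨N, hN⟩ := Metric.cauchySeq_iff.1 hf (ε / 2) (by positivity)
  refine ⟨N, fun m hm => ?_⟩
  refine lt_of_le_of_lt (ciSup_le fun i => ?_) (half_lt_self hε)
  have hlim : Filter.Tendsto (fun l => (1 / 2 : ℝ) ^ i * dist (f m i) (f l i)) Filter.atTop
      (nhds ((1 / 2 : ℝ) ^ i * dist (f m i) (g i))) :=
    (tendsto_const_nhds.dist (hg i)).const_mul _
  refine le_of_tendsto hlim ?_
  filter_upwards [Filter.eventually_ge_atTop N] with l hl
  exact (le_omegaDist h1 _ _ i).trans (hN m hm l hl).le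

/-- `ρ` is a pseudo-metric on `Z`. -/
structure IsPseudoMetric {Z : Type w} (ρ : Z → Z → ℝ) : Prop where
  self : ∀ x, ρ x x = 0
  symm : ∀ x y, ρ x y = ρ y x
  triangle : ∀ x y z, ρ x z ≤ ρ x y + ρ y z

theorem IsPseudoMetric.le_rawModulus {s : L.Srt} {ρ : Formula L ![s, s]}
    {A : MetricStructure.{u, v, w} L} (h : IsPseudoMetric (ρ.eval₂ A)) (t : unitInterval)
    {x y : A.carrier s} (hxy : dist x y ≤ t) : ρ.eval₂ A x y ≤ ρ.rawModulus t := by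
  have h4 := ρ.abs_eval₂_sub_le A t x y y y hxy ((dist_self y).trans_le t.2.1)
  rw [h.self, sub_zero] at h4
  exact (le_abs_self _).trans h4

/-- The set `Z`, to be equipped with the pseudo-metric `ρ`. -/
def PseudoCopy {Z : Type w} (ρ : Z → Z → ℝ) (_ : IsPseudoMetric ρ) : Type w := Z

instance {Z : Type w} (ρ : Z → Z → ℝ) (h : IsPseudoMetric ρ) :
    PseudoMetricSpace (PseudoCopy ρ h) where
  dist := ρ
  dist_self := h.self
  dist_comm := h.symm
  dist_triangle := h.triangle

/-- The quotient `Z / ρ`: the (separated) metric completion of `Z` with the pseudo-metric `ρ`, that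
is, the completion of the metric space of classes of points at `ρ`-distance `0`. -/
abbrev PseudoQuot {Z : Type w} (ρ : Z → Z → ℝ) (h : IsPseudoMetric ρ) : Type w :=
  Completion (PseudoCopy ρ h)

/-- The class of `x` in `Z / ρ`. -/
def PseudoQuot.mk {Z : Type w} (ρ : Z → Z → ℝ) (h : IsPseudoMetric ρ) (x : Z) : PseudoQuot ρ h :=
  ((show PseudoCopy ρ h from x : PseudoCopy ρ h) : Completion (PseudoCopy ρ h))

theorem PseudoQuot.dist_mk {Z : Type w} (ρ : Z → Z → ℝ) (h : IsPseudoMetric ρ) (x y : Z) :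
    dist (PseudoQuot.mk ρ h x) (PseudoQuot.mk ρ h y) = ρ x y :=
  Completion.dist_eq (α := PseudoCopy ρ h) x y

theorem PseudoQuot.dist_le_one {Z : Type w} (ρ : Z → Z → ℝ) (h : IsPseudoMetric ρ)
    (h1 : ∀ x y, ρ x y ≤ 1) (a b : PseudoQuot ρ h) : dist a b ≤ 1 := by
  refine Completion.induction_on₂ a b (isClosed_le continuous_dist continuous_const) ?_
  intro x y
  rw [Completion.dist_eq]
  exact h1 x y

/-! ### Expanding a signature and a structure by a new sort -/

/-- Add a new sort `none` and new binary predicate symbols indexed by `N`. -/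
@[reducible] def MetricSignature.expand (L : MetricSignature.{u, v}) (N : Type)
    (newDom : N → Fin 2 → Option L.Srt) (newMod : N → Modulus) : MetricSignature.{u, v} where
  Srt := Option L.Srt
  Pred := L.Pred ⊕ N
  arity := Sum.elim L.arity (fun _ => 2)
  dom P := match P with
    | .inl P => fun i => some (L.dom P i)
    | .inr j => newDom j
  modulus := Sum.elim L.modulus newMod

/-- The universes after a new sort with universe `Z` has been added. -/
@[reducible] def expandCarrier (A : MetricStructure.{u, v, w} L) (Z : Type w) :
    Option L.Srt → Type w
  | none => Z
  | some s => A.carrier s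

/-- The metrics after a new sort has been added. -/
@[reducible] instance expandMetric (A : MetricStructure.{u, v, w} L) (Z : Type w)
    [hZ : MetricSpace Z] : (s : Option L.Srt) → MetricSpace (expandCarrier A Z s)
  | none => hZ
  | some s => A.metric s

/-- The structure obtained from `A` by adding a new sort with universe `Z` and interpreting the new
predicate symbols by `R`. -/
@[reducible] def MetricStructure.expand (A : MetricStructure.{u, v, w} L) (N : Type)
    (newDom : N → Fin 2 → Option L.Srt) (newMod : N → Modulus)
    (Z : Type w) [hZ : MetricSpace Z] [cZ : CompleteSpace Z] [nZ : Nonempty Z]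
    (hd : ∀ x y : Z, dist x y ≤ 1)
    (R : (j : N) → ((i : Fin 2) → expandCarrier A Z (newDom j i)) → ℝ)
    (hR : ∀ j a, R j a ∈ Icc (0 : ℝ) 1)
    (hmod : ∀ j (a b : (i : Fin 2) → expandCarrier A Z (newDom j i)),
      |R j a - R j b| ≤ ((newMod j).toFun (clamp (dist a b)) : ℝ)) :
    MetricStructure.{u, v, w} (L.expand N newDom newMod) where
  carrier := expandCarrier A Z
  metric := expandMetric A Z
  complete s := match s with
    | none => cZ
    | some s => A.complete s
  nonempty s := match s with
    | none => nZ
    | some s => A.nonempty s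
  dist_le_one s := match s with
    | none => hd
    | some s => A.dist_le_one s
  interp P := match P with
    | .inl P => fun a => A.interp P a
    | .inr j => R j
  interp_mem P := match P with
    | .inl P => fun a => A.interp_mem P a
    | .inr j => hR j
  interp_modulus P := match P with
    | .inl P => fun a b => A.interp_modulus P a b
    | .inr j => hmod j

/-! ### Imaginary expansions, uniformly over a family of structures -/

/-- `φ` is, in the structure `A`, the distance predicate of a nonempty set. -/
def IsDistancePredicate {s : L.Srt} (φ : Formula L ![s]) (A : MetricStructure.{u, v, w} L) :
    Prop :=
  ∃ D : Set (A.carrier s), D.Nonempty ∧ ∀ x, φ.eval₁ A x = Metric.infDist x D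

/-- The (closed) definable set whose distance predicate is `φ`. -/
abbrev DefinableSet {s : L.Srt} (φ : Formula L ![s]) (A : MetricStructure.{u, v, w} L) :
    Type w :=
  {x : A.carrier s // φ.eval₁ A x = 0}

theorem DefinableSet.complete {s : L.Srt} {φ : Formula L ![s]} {A : MetricStructure.{u, v, w} L}
    (h : IsDistancePredicate φ A) : CompleteSpace (DefinableSet φ A) := by
  obtain ⟨D, -, hD⟩ := h
  refine IsClosed.completeSpace_coe (s := {x | φ.eval₁ A x = 0}) (hs := ?_)
  simp only [hD]
  exact isClosed_eq (Metric.continuous_infDist_pt D) continuous_const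

theorem DefinableSet.nonempty {s : L.Srt} {φ : Formula L ![s]} {A : MetricStructure.{u, v, w} L}
    (h : IsDistancePredicate φ A) : Nonempty (DefinableSet φ A) := by
  obtain ⟨D, ⟨x, hx⟩, hD⟩ := h
  exact ⟨⟨x, by rw [hD, Metric.infDist_zero_of_mem hx]⟩⟩

theorem abs_sub_le_one {x y : ℝ} (hx : x ∈ Icc (0 : ℝ) 1) (hy : y ∈ Icc (0 : ℝ) 1) :
    |x - y| ≤ 1 := by
  rw [abs_le]
  constructor <;> linarith [hx.1, hx.2, hy.1, hy.2]

theorem abs_dist_sub_dist_le {M : Type*} [PseudoMetricSpace M] {p q p' q' : M} {c d : ℝ}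
    (hp : dist p p' ≤ c) (hq : dist q q' ≤ d) : |dist p q - dist p' q'| ≤ c + d := by
  have h := dist_dist_dist_le p q p' q'
  rw [Real.dist_eq] at h
  linarith

theorem dist_pair_le (A : MetricStructure.{u, v, w} L) {Z : Type w} [MetricSpace Z]
    (hd : ∀ x y : Z, dist x y ≤ 1) {D : Fin 2 → Option L.Srt}
    (a b : (i : Fin 2) → expandCarrier A Z (D i)) (i : Fin 2) :
    dist (a i) (b i) ≤ (clamp (dist a b) : ℝ) := by
  refine le_clamp ?_ (dist_le_pi_dist a b i)
  generalize a i = x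
  generalize b i = y
  revert x y
  cases D i with
  | none => exact hd
  | some s => exact A.dist_le_one s

variable {K : Type k}

/-- One imaginary expansion, given by the same data for all members of a family `F` of structures:
a finite nonempty product of sorts, an `ω`-product of sorts, a definable set, or the quotient by a
definable pseudo-metric. -/
inductive ImaginaryStep (F : K → MetricStructure.{u, v, w} L) : Type (max u v w k)
  | finProd (n : ℕ) (O : Fin (n + 1) → L.Srt) : ImaginaryStep F
  | omegaProd (O : ℕ → L.Srt) : ImaginaryStep F
  | defSet (O : L.Srt) (φ : Formula L ![O]) (h : ∀ i, IsDistancePredicate φ (F i)) :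
      ImaginaryStep F
  | quotient (O : L.Srt) (ρ : Formula L ![O, O]) (h : ∀ i, IsPseudoMetric (ρ.eval₂ (F i))) :
      ImaginaryStep F

/-- The signature of an imaginary expansion; `none` is the new sort. The new predicate symbols are
the projections `π_j` on `P × O_j`, the inclusion `ι` on `O_D × O`, and the quotient map `q` on
`O × O/ρ`. -/
@[reducible] def ImaginaryStep.sig {F : K → MetricStructure.{u, v, w} L} :
    ImaginaryStep F → MetricSignature.{u, v}
  | finProd n O => L.expand (Fin (n + 1)) (fun j => ![none, some (O j)])
      (fun _ => Modulus.linear 2)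
  | omegaProd O => L.expand ℕ (fun j => ![none, some (O j)])
      (fun j => Modulus.linear (2 ^ j + 1))
  | defSet O _ _ => L.expand Unit (fun _ => ![none, some O]) (fun _ => Modulus.linear 2)
  | quotient O ρ _ => L.expand Unit (fun _ => ![some O, none])
      (fun _ => Modulus.ofReal (fun t => ρ.rawModulus t + t)
        (by have := ρ.rawModulus_continuous; fun_prop) (by simp [ρ.rawModulus_zero]))

/-- Append the sort `∏_j O_j` with the maximum metric and `π_j (x, y) = d (x j, y)`. -/
@[reducible] def finProdStr (A : MetricStructure.{u, v, w} L) (n : ℕ) (O : Fin (n + 1) → L.Srt) :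
    MetricStructure.{u, v, w} (L.expand (Fin (n + 1)) (fun j => ![none, some (O j)])
      (fun _ => Modulus.linear 2)) :=
  A.expand _ _ _ ((j : Fin (n + 1)) → A.carrier (O j))
    (hd := fun _ _ => (dist_pi_le_iff zero_le_one).2 fun _ => A.dist_le_one _ _ _)
    (R := fun j a =>
      let x : (j : Fin (n + 1)) → A.carrier (O j) := a 0
      let y : A.carrier (O j) := a 1
      dist (x j) y)
    (hR := fun _ _ => ⟨dist_nonneg, A.dist_le_one _ _ _⟩)
    (hmod := fun j a b => by
      refine le_clamp (abs_sub_le_one ⟨dist_nonneg, A.dist_le_one _ _ _⟩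
        ⟨dist_nonneg, A.dist_le_one _ _ _⟩) ?_
      have h := dist_pair_le A
        (fun _ _ => (dist_pi_le_iff zero_le_one).2 fun _ => A.dist_le_one _ _ _) a b
      have h0 : dist (a 0 : (j : Fin (n + 1)) → A.carrier (O j)) (b 0) ≤ _ := h 0
      have h1 : dist (a 1 : A.carrier (O j)) (b 1) ≤ _ := h 1
      have h2 := dist_le_pi_dist (a 0 : (j : Fin (n + 1)) → A.carrier (O j)) (b 0) j
      exact (abs_dist_sub_dist_le (h2.trans h0) h1).trans_eq (two_mul _).symm)

/-- Append the sort `∏_j O_j`, `j < ω`, with the metric `sup_j 2 ^ (-j) d (x j, y j)` and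
`π_j (x, y) = d (x j, y)`. -/
@[reducible] def omegaProdStr (A : MetricStructure.{u, v, w} L) (O : ℕ → L.Srt) :
    MetricStructure.{u, v, w} (L.expand ℕ (fun j => ![none, some (O j)])
      (fun j => Modulus.linear (2 ^ j + 1))) :=
  A.expand _ _ _ (OmegaProd fun j => A.carrier (O j))
    (hZ := omegaMetric fun j => A.dist_le_one (O j))
    (cZ := omega_complete fun j => A.dist_le_one (O j))
    (nZ := ⟨fun _ => Classical.arbitrary _⟩)
    (hd := fun x y => ciSup_le fun i => omegaDist_bdd (fun j => A.dist_le_one (O j)) x y i)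
    (R := fun j a =>
      let x : (j : ℕ) → A.carrier (O j) := a 0
      let y : A.carrier (O j) := a 1
      dist (x j) y)
    (hR := fun _ _ => ⟨dist_nonneg, A.dist_le_one _ _ _⟩)
    (hmod := fun j a b => by
      refine le_clamp (abs_sub_le_one ⟨dist_nonneg, A.dist_le_one _ _ _⟩
        ⟨dist_nonneg, A.dist_le_one _ _ _⟩) ?_
      let _ := omegaMetric fun j => A.dist_le_one (O j)
      have h := dist_pair_le A (Z := OmegaProd fun j => A.carrier (O j))
        (fun x y => ciSup_le fun i => omegaDist_bdd (fun j => A.dist_le_one (O j)) x y i) a b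
      have h0 : omegaDist (a 0 : OmegaProd fun j => A.carrier (O j)) (b 0) ≤ _ := h 0
      have h1 : dist (a 1 : A.carrier (O j)) (b 1) ≤ _ := h 1
      have h2 := dist_le_omegaDist (fun j => A.dist_le_one (O j))
        (a 0 : OmegaProd fun j => A.carrier (O j)) (b 0) j
      have h4 := mul_le_mul_of_nonneg_left h0 (by positivity : (0 : ℝ) ≤ 2 ^ j)
      exact (abs_dist_sub_dist_le (h2.trans h4) h1).trans_eq (add_one_mul _ _).symm)

/-- Append the definable set `D` with distance predicate `φ` as a sort, with the restricted metric
and `ι (x, y) = d (x, y)`. -/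
@[reducible] def defSetStr (A : MetricStructure.{u, v, w} L) (O : L.Srt) (φ : Formula L ![O])
    (h : IsDistancePredicate φ A) :
    MetricStructure.{u, v, w} (L.expand Unit (fun _ => ![none, some O])
      (fun _ => Modulus.linear 2)) :=
  A.expand _ _ _ (DefinableSet φ A)
    (cZ := DefinableSet.complete h)
    (nZ := DefinableSet.nonempty h)
    (hd := fun _ _ => A.dist_le_one _ _ _)
    (R := fun _ a =>
      let x : DefinableSet φ A := a 0
      let y : A.carrier O := a 1
      dist x.1 y)
    (hR := fun _ _ => ⟨dist_nonneg, A.dist_le_one _ _ _⟩)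
    (hmod := fun j a b => by
      refine le_clamp (abs_sub_le_one ⟨dist_nonneg, A.dist_le_one _ _ _⟩
        ⟨dist_nonneg, A.dist_le_one _ _ _⟩) ?_
      have h := dist_pair_le A (Z := DefinableSet φ A) (fun _ _ => A.dist_le_one _ _ _) a b
      have h0 : dist (a 0 : DefinableSet φ A).1 (b 0 : DefinableSet φ A).1 ≤ _ := h 0
      have h1 : dist (a 1 : A.carrier O) (b 1) ≤ _ := h 1
      exact (abs_dist_sub_dist_le h0 h1).trans_eq (two_mul _).symm)

/-- Append the quotient of the sort `O` by the definable pseudo-metric `ρ` (completed), with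
`q (x, y) = d ([x], y)`, so that `q (x, [y]) = ρ (x, y)`. -/
@[reducible] def quotientStr (A : MetricStructure.{u, v, w} L) (O : L.Srt)
    (ρ : Formula L ![O, O]) (h : IsPseudoMetric (ρ.eval₂ A)) :
    MetricStructure.{u, v, w} (L.expand Unit (fun _ => ![some O, none])
      (fun _ => Modulus.ofReal (fun t => ρ.rawModulus t + t)
        (by have := ρ.rawModulus_continuous; fun_prop) (by simp [ρ.rawModulus_zero]))) :=
  A.expand _ _ _ (PseudoQuot (ρ.eval₂ A) h)
    (nZ := ⟨PseudoQuot.mk _ h (Classical.arbitrary _)⟩)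
    (hd := PseudoQuot.dist_le_one _ h fun _ _ => (ρ.eval_mem A _).2)
    (R := fun _ a =>
      let x : A.carrier O := a 0
      let y : PseudoQuot (ρ.eval₂ A) h := a 1
      dist (PseudoQuot.mk _ h x) y)
    (hR := fun _ _ => ⟨dist_nonneg, PseudoQuot.dist_le_one _ h (fun _ _ => (ρ.eval_mem A _).2) _ _⟩)
    (hmod := fun j a b => by
      have hd := PseudoQuot.dist_le_one _ h fun _ _ => (ρ.eval_mem A _).2
      refine le_clamp (abs_sub_le_one ⟨dist_nonneg, hd _ _⟩ ⟨dist_nonneg, hd _ _⟩) ?_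
      have hp := dist_pair_le A (Z := PseudoQuot (ρ.eval₂ A) h) hd a b
      have h0 : dist (a 0 : A.carrier O) (b 0) ≤ _ := hp 0
      have h1 : dist (a 1 : PseudoQuot (ρ.eval₂ A) h) (b 1) ≤ _ := hp 1
      have h5 : dist (PseudoQuot.mk _ h (a 0)) (PseudoQuot.mk _ h (b 0)) ≤ _ :=
        (PseudoQuot.dist_mk _ h _ _).trans_le (IsPseudoMetric.le_rawModulus h _ h0)
      exact abs_dist_sub_dist_le h5 h1)

/-- The expanded structures of an imaginary expansion. -/
@[reducible] def ImaginaryStep.str {F : K → MetricStructure.{u, v, w} L} :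
    (S : ImaginaryStep F) → K → MetricStructure.{u, v, w} S.sig
  | finProd n O, i => finProdStr (F i) n O
  | omegaProd O, i => omegaProdStr (F i) O
  | defSet O φ h, i => defSetStr (F i) O φ (h i)
  | quotient O ρ h, i => quotientStr (F i) O ρ (h i)

/-- Iterated imaginary expansions, uniformly over a family `F` of structures. -/
inductive ImaginaryExpansion : {L : MetricSignature.{u, v}} →
    (K → MetricStructure.{u, v, w} L) → Type (max (u + 1) (v + 1) (w + 1) k)
  | refl {L : MetricSignature.{u, v}} (F : K → MetricStructure.{u, v, w} L) :
      ImaginaryExpansion F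
  | step {L : MetricSignature.{u, v}} {F : K → MetricStructure.{u, v, w} L}
      (S : ImaginaryStep F) (E : ImaginaryExpansion S.str) : ImaginaryExpansion F

/-- The signature of an iterated imaginary expansion. -/
@[reducible] def ImaginaryExpansion.sig {L : MetricSignature.{u, v}}
    {F : K → MetricStructure.{u, v, w} L} : ImaginaryExpansion F → MetricSignature.{u, v}
  | refl (L := L) _ => L
  | step _ E => E.sig

/-- The expanded structures of an iterated imaginary expansion. -/
@[reducible] def ImaginaryExpansion.str {L : MetricSignature.{u, v}}
    {F : K → MetricStructure.{u, v, w} L} :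
    (E : ImaginaryExpansion F) → K → MetricStructure.{u, v, w} E.sig
  | refl F => F
  | step _ E => E.str

/-- The class `C_{L,r}`, for the home sort `H`: the structures whose home sort has diameter at
least `r`. -/
def StructureClass (L : MetricSignature.{u, v}) (H : L.Srt) (r : ℝ) :=
  {A : MetricStructure.{u, v, w} L // r ≤ Metric.diam (univ : Set (A.carrier H))}

/-- The members of `C_{L,r}`, as a family of structures. -/
def StructureClass.family (L : MetricSignature.{u, v}) (H : L.Srt) (r : ℝ) :
    StructureClass.{u, v, w} L H r → MetricStructure.{u, v, w} L :=
  Subtype.val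

end

end ContLogic

namespace ContLogic

open Set

noncomputable section

/-! ### Systems of connectives and uniform approximation -/

/-! The space `X` is realised inside a function space that does not depend on the structure. Let T
send a sequence z of points of `H` to the point of the Hilbert cube with coordinates min((2/r) d(z
0, z (n+1)), 1). Since the diameter is at least r, some two points lie at distance at least r/2, and
sequences in these two points already reach every 0-1 sequence (`exists_cubeMap_eq`). So the image
of T always contains the Cantor space, whatever else it contains.

The Cantor space maps onto `X`, and `X` embeds isometrically in C(X) by Kuratowski's map κ. By
Tietze the composite extends to a continuous M from the whole cube to C(X)
(`exists_cube_extension`). The pseudo-metric ρ(z, z') = ‖M(T z) - M(T z')‖ is then given by one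
formula for all structures. The quotient of the ω-power of `H` by ρ may vary with the structure, but
it always contains a copy of κ(X), and this copy is a definable set: its distance predicate at y is
the infimum over z of d([z], y) + dist(M(T z), κ(X)). Distances to single points of the copy have
the same shape, with κ(p) in place of κ(X) (`exists_expansion_of_cubeMap`).

That continuous functions of definable quantities are formulas rests on two facts. The uniform
limits of rescaled restricted formulas form a vector lattice with constants, so the lattice
Stone-Weierstrass theorem applies (`comp_mem_uniformSpan`); and a `[0,1]`-valued member of it is
exactly a series ∑ 2^(-(n+1)) ψ_n of restricted formulas (`exists_series`). Applied to the distances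
to the points of the copy, which separate points, this also yields all continuous functions on
powers of `X`. -/

/-- A set of `[0,1]`-valued functions which is closed under the connectives `0`, `1`, `x / 2` and
truncated subtraction. -/
structure ConnectiveClosed {Ω : Type*} (R : Set (Ω → ℝ)) : Prop where
  mem_Icc : ∀ φ ∈ R, ∀ ω, φ ω ∈ Icc (0 : ℝ) 1
  zero : (fun _ => 0) ∈ R
  one : (fun _ => 1) ∈ R
  half : ∀ φ ∈ R, (fun ω => φ ω / 2) ∈ R
  tsub : ∀ φ ∈ R, ∀ ψ ∈ R, (fun ω => max (φ ω - ψ ω) 0) ∈ R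

/-- The real-valued functions `2 ^ N * (2 * φ - 1)` with `φ ∈ R`. -/
def dyadicSpan {Ω : Type*} (R : Set (Ω → ℝ)) : Set (Ω → ℝ) :=
  {f | ∃ N : ℕ, ∃ φ ∈ R, ∀ ω, f ω = 2 ^ N * (2 * φ ω - 1)}

/-- The uniform limits of functions in `dyadicSpan R`. -/
def uniformSpan {Ω : Type*} (R : Set (Ω → ℝ)) : Set (Ω → ℝ) :=
  {f | ∀ ε > 0, ∃ g ∈ dyadicSpan R, ∀ ω, |g ω - f ω| ≤ ε}

namespace ConnectiveClosed

variable {Ω : Type*} {R : Set (Ω → ℝ)}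

/-! ### Derived connectives -/

theorem one_sub (hR : ConnectiveClosed R) {φ : Ω → ℝ} (hφ : φ ∈ R) :
    (fun ω => 1 - φ ω) ∈ R := by
  convert hR.tsub _ hR.one _ hφ using 2 with ω
  rw [max_eq_left]
  linarith [(hR.mem_Icc _ hφ ω).2]

theorem tadd (hR : ConnectiveClosed R) {φ ψ : Ω → ℝ} (hφ : φ ∈ R) (hψ : ψ ∈ R) :
    (fun ω => min (φ ω + ψ ω) 1) ∈ R := by
  -- Truncated addition is dual to truncated subtraction under φ ↦ 1 - φ.
  convert hR.one_sub (hR.tsub _ (hR.one_sub hφ) _ hψ) using 2 with ω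
  rcases le_total (φ ω + ψ ω) 1 with h | h
  · rw [min_eq_left h, max_eq_left] <;> linarith
  · rw [min_eq_right h, max_eq_right] <;> linarith

theorem average (hR : ConnectiveClosed R) {φ ψ : Ω → ℝ} (hφ : φ ∈ R) (hψ : ψ ∈ R) :
    (fun ω => (φ ω + ψ ω) / 2) ∈ R := by
  convert hR.tadd (hR.half _ hφ) (hR.half _ hψ) using 2 with ω
  rw [min_eq_left] <;> linarith [(hR.mem_Icc _ hφ ω).2, (hR.mem_Icc _ hψ ω).2]

theorem max_mem (hR : ConnectiveClosed R) {φ ψ : Ω → ℝ} (hφ : φ ∈ R) (hψ : ψ ∈ R) :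
    (fun ω => max (φ ω) (ψ ω)) ∈ R := by
  convert hR.tadd hψ (hR.tsub _ hφ _ hψ) using 2 with ω
  have h1 := (hR.mem_Icc _ hφ ω).2
  have h2 := (hR.mem_Icc _ hψ ω).2
  rcases le_total (φ ω) (ψ ω) with h | h
  · rw [max_eq_right h, max_eq_right (by linarith), min_eq_left] <;> linarith
  · rw [max_eq_left h, max_eq_left (by linarith), min_eq_left] <;> linarith

/-- Truncated multiplication by a power of two. -/
theorem double (hR : ConnectiveClosed R) {φ : Ω → ℝ} (hφ : φ ∈ R) (N : ℕ) :
    (fun ω => min (2 ^ N * φ ω) 1) ∈ R := by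
  induction N with
  | zero =>
    convert hφ using 2 with ω
    simpa using (hR.mem_Icc _ hφ ω).2
  | succ N ih =>
    convert hR.tadd ih ih using 2 with ω
    have h := (hR.mem_Icc _ hφ ω).1
    rcases le_total (2 ^ N * φ ω) 1 with h' | h'
    · rw [min_eq_left h', pow_succ]
      ring_nf
    · rw [min_eq_right h', pow_succ, min_eq_right, min_eq_right] <;> linarith

/-! ### The uniform span as a vector lattice -/

/-- Averaging φ with 1/2 halves 2φ - 1, which pays for one more factor of 2. Two functions can
therefore be brought to the same scale. -/
theorem exists_dyadic_le (hR : ConnectiveClosed R) {f : Ω → ℝ} {N M : ℕ} (hNM : N ≤ M)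
    (hf : ∃ φ ∈ R, ∀ ω, f ω = 2 ^ N * (2 * φ ω - 1)) :
    ∃ φ ∈ R, ∀ ω, f ω = 2 ^ M * (2 * φ ω - 1) := by
  induction M, hNM using Nat.le_induction with
  | base => exact hf
  | succ M _ ih =>
    obtain ⟨φ, hφ, h⟩ := ih
    refine ⟨_, hR.average hφ (hR.half _ hR.one), fun ω => ?_⟩
    rw [h, pow_succ]
    ring

theorem exists_common_dyadic (hR : ConnectiveClosed R) {f g : Ω → ℝ} (hf : f ∈ dyadicSpan R)
    (hg : g ∈ dyadicSpan R) : ∃ N : ℕ, ∃ φ ∈ R, ∃ ψ ∈ R,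
      (∀ ω, f ω = 2 ^ N * (2 * φ ω - 1)) ∧ ∀ ω, g ω = 2 ^ N * (2 * ψ ω - 1) := by
  obtain ⟨N, hf⟩ := hf
  obtain ⟨M, hg⟩ := hg
  obtain ⟨φ, hφ, hf⟩ := hR.exists_dyadic_le (le_max_left N M) hf
  obtain ⟨ψ, hψ, hg⟩ := hR.exists_dyadic_le (le_max_right N M) hg
  exact ⟨_, φ, hφ, ψ, hψ, hf, hg⟩

theorem subset_uniformSpan (hR : ConnectiveClosed R) : R ⊆ uniformSpan R := by
  intro φ hφ ε hε
  refine ⟨φ, ⟨0, _, hR.average hφ hR.one, fun ω => by ring⟩, fun ω => by simpa using hε.le⟩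

theorem add_mem (hR : ConnectiveClosed R) {f g : Ω → ℝ} (hf : f ∈ uniformSpan R)
    (hg : g ∈ uniformSpan R) : (fun ω => f ω + g ω) ∈ uniformSpan R := by
  intro ε hε
  obtain ⟨f', hf', h1⟩ := hf (ε / 2) (by positivity)
  obtain ⟨g', hg', h2⟩ := hg (ε / 2) (by positivity)
  obtain ⟨N, φ, hφ, ψ, hψ, h3, h4⟩ := hR.exists_common_dyadic hf' hg'
  refine ⟨fun ω => f' ω + g' ω, ⟨N + 1, _, hR.average hφ hψ, fun ω => ?_⟩, fun ω => ?_⟩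
  · simp only [h3, h4, pow_succ]
    ring
  · rw [add_sub_add_comm]
    exact (abs_add_le _ _).trans (by linarith [h1 ω, h2 ω])

theorem max_mem_uniformSpan (hR : ConnectiveClosed R) {f g : Ω → ℝ} (hf : f ∈ uniformSpan R)
    (hg : g ∈ uniformSpan R) : (fun ω => max (f ω) (g ω)) ∈ uniformSpan R := by
  intro ε hε
  obtain ⟨f', hf', h1⟩ := hf ε hε
  obtain ⟨g', hg', h2⟩ := hg ε hε
  obtain ⟨N, φ, hφ, ψ, hψ, h3, h4⟩ := hR.exists_common_dyadic hf' hg'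
  refine ⟨fun ω => max (f' ω) (g' ω), ⟨N, _, hR.max_mem hφ hψ, fun ω => ?_⟩, fun ω => ?_⟩
  · have hp : (0 : ℝ) < 2 ^ N := by positivity
    simp only [h3, h4]
    rcases le_total (φ ω) (ψ ω) with h | h
    · rw [max_eq_right h, max_eq_right]
      gcongr
    · rw [max_eq_left h, max_eq_left]
      gcongr
  · exact (abs_max_sub_max_le_max _ _ _ _).trans (max_le (h1 ω) (h2 ω))

theorem neg_mem (hR : ConnectiveClosed R) {f : Ω → ℝ} (hf : f ∈ uniformSpan R) :
    (fun ω => -f ω) ∈ uniformSpan R := by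
  intro ε hε
  obtain ⟨f', ⟨N, φ, hφ, h⟩, h1⟩ := hf ε hε
  refine ⟨fun ω => -f' ω, ⟨N, _, hR.one_sub hφ, fun ω => ?_⟩, fun ω => ?_⟩
  · simp only [h]
    ring
  · rw [neg_sub_neg, abs_sub_comm]
    exact h1 ω

theorem half_mem (hR : ConnectiveClosed R) {f : Ω → ℝ} (hf : f ∈ uniformSpan R) :
    (fun ω => f ω / 2) ∈ uniformSpan R := by
  intro ε hε
  obtain ⟨f', ⟨N, φ, hφ, h⟩, h1⟩ := hf ε hε
  refine ⟨fun ω => f' ω / 2, ⟨N, _, hR.average hφ (hR.half _ hR.one), fun ω => ?_⟩, fun ω => ?_⟩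
  · simp only [h]
    ring
  · rw [← sub_div, abs_div, abs_two]
    linarith [h1 ω]

theorem min_mem_uniformSpan (hR : ConnectiveClosed R) {f g : Ω → ℝ} (hf : f ∈ uniformSpan R)
    (hg : g ∈ uniformSpan R) : (fun ω => min (f ω) (g ω)) ∈ uniformSpan R := by
  convert hR.neg_mem (hR.max_mem_uniformSpan (hR.neg_mem hf) (hR.neg_mem hg)) using 2 with ω
  rw [max_neg_neg, neg_neg]

theorem mem_uniformSpan_of_limit {f : Ω → ℝ}
    (hf : ∀ ε > 0, ∃ g ∈ uniformSpan R, ∀ ω, |g ω - f ω| ≤ ε) : f ∈ uniformSpan R := by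
  intro ε hε
  obtain ⟨g, hg, h1⟩ := hf (ε / 2) (by positivity)
  obtain ⟨g', hg', h2⟩ := hg (ε / 2) (by positivity)
  refine ⟨g', hg', fun ω => (abs_sub_le _ (g ω) _).trans ?_⟩
  linarith [h1 ω, h2 ω]

theorem bounded (hR : ConnectiveClosed R) {f : Ω → ℝ} (hf : f ∈ uniformSpan R) :
    ∃ B : ℝ, 0 ≤ B ∧ ∀ ω, |f ω| ≤ B := by
  obtain ⟨f', ⟨N, φ, hφ, h⟩, h1⟩ := hf 1 one_pos
  refine ⟨2 ^ N + 1, by positivity, fun ω => ?_⟩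
  have h2 : |f' ω| ≤ 2 ^ N := by
    rw [h, abs_mul, abs_of_nonneg (by positivity : (0 : ℝ) ≤ 2 ^ N)]
    refine mul_le_of_le_one_right (by positivity) ?_
    have := hR.mem_Icc _ hφ ω
    rw [abs_le]
    constructor <;> linarith [this.1, this.2]
  have h3 := h1 ω
  rw [abs_le] at *
  constructor <;> linarith

/-- The real scalars which multiply a function into the uniform span. -/
def scalars (hR : ConnectiveClosed R) (f : Ω → ℝ) : AddSubgroup ℝ where
  carrier := {c | (fun ω => c * f ω) ∈ uniformSpan R}
  zero_mem' := by
    change (fun ω => 0 * f ω) ∈ uniformSpan R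
    simp only [zero_mul]
    exact hR.subset_uniformSpan hR.zero
  add_mem' {a b} ha hb := by
    change (fun ω => (a + b) * f ω) ∈ uniformSpan R
    simp only [add_mul]
    exact hR.add_mem ha hb
  neg_mem' {a} ha := by
    change (fun ω => -a * f ω) ∈ uniformSpan R
    simp only [neg_mul]
    exact hR.neg_mem ha

/-- The admissible scalars form an additive subgroup of the reals containing every 2^(-n), hence a
dense one. As `f` is bounded, approximating the scalar approximates the product uniformly. -/
theorem smul_mem (hR : ConnectiveClosed R) {f : Ω → ℝ} (hf : f ∈ uniformSpan R) (c : ℝ) :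
    (fun ω => c * f ω) ∈ uniformSpan R := by
  have hpow : ∀ n : ℕ, (1 / 2 : ℝ) ^ n ∈ hR.scalars f := fun n => by
    induction n with
    | zero =>
      change (fun ω => (1 / 2 : ℝ) ^ 0 * f ω) ∈ uniformSpan R
      simpa using hf
    | succ n ih =>
      change (fun ω => (1 / 2 : ℝ) ^ (n + 1) * f ω) ∈ uniformSpan R
      convert hR.half_mem (f := fun ω => (1 / 2 : ℝ) ^ n * f ω) ih using 2 with ω
      rw [pow_succ]
      ring
  have hdense : Dense (hR.scalars f : Set ℝ) := by
    refine AddSubgroup.dense_of_not_isolated_zero _ fun ε hε => ?_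
    obtain ⟨n, hn⟩ := exists_pow_lt_of_lt_one hε (by norm_num : (1 / 2 : ℝ) < 1)
    exact ⟨_, hpow n, by positivity, hn⟩
  obtain ⟨B, hB, hf'⟩ := hR.bounded hf
  refine mem_uniformSpan_of_limit fun ε hε => ?_
  obtain ⟨c', hc', hcc⟩ := hdense.exists_dist_lt c (ε := ε / (B + 1)) (by positivity)
  refine ⟨_, hc', fun ω => ?_⟩
  rw [← sub_mul, abs_mul, abs_sub_comm, ← Real.dist_eq]
  calc dist c c' * |f ω| ≤ ε / (B + 1) * (B + 1) := by
        gcongr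
        linarith [hf' ω]
    _ = ε := by field_simp

theorem const_mem (hR : ConnectiveClosed R) (c : ℝ) : (fun _ => c) ∈ uniformSpan R := by
  simpa using hR.smul_mem (hR.subset_uniformSpan hR.one) c

/-- The lattice version of the Stone-Weierstrass theorem for uniform spans. -/
theorem comp_mem_uniformSpan (hR : ConnectiveClosed R) {M : Type*} [TopologicalSpace M]
    [CompactSpace M] (g : Ω → M)
    (hsep : ∀ x y : M, x ≠ y → ∃ u : C(M, ℝ), (fun ω => u (g ω)) ∈ uniformSpan R ∧ u x ≠ u y)
    (f : C(M, ℝ)) : (fun ω => f (g ω)) ∈ uniformSpan R := by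
  set S : Set C(M, ℝ) := {u | (fun ω => u (g ω)) ∈ uniformSpan R} with hS
  have hcl : closure S = ⊤ := by
    refine ContinuousMap.sublattice_closure_eq_top S ⟨0, hR.const_mem 0⟩
      (fun u hu v hv => hR.min_mem_uniformSpan hu hv)
      (fun u hu v hv => hR.max_mem_uniformSpan hu hv) fun v x y => ?_
    rcases eq_or_ne x y with rfl | hxy
    · exact ⟨ContinuousMap.const _ (v x), hR.const_mem _, rfl, rfl⟩
    · obtain ⟨u, hu, hne⟩ := hsep x y hxy
      -- Two-point interpolation: the affine function of the separating `u` that agrees with `v` at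
      -- `x` and at `y`.
      refine ⟨ContinuousMap.const _ (v x) + ((v y - v x) / (u y - u x)) •
        (u - ContinuousMap.const _ (u x)), ?_, by simp, ?_⟩
      · exact hR.add_mem (hR.const_mem _) (hR.smul_mem
          (by simpa [sub_eq_add_neg] using hR.add_mem hu (hR.const_mem (-(u x)))) _)
      · have : u y - u x ≠ 0 := sub_ne_zero.2 hne.symm
        simp only [ContinuousMap.add_apply, ContinuousMap.const_apply, ContinuousMap.smul_apply,
          ContinuousMap.sub_apply, smul_eq_mul]
        field_simp
        ring
  refine mem_uniformSpan_of_limit fun ε hε => ?_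
  have hf : f ∈ closure S := hcl ▸ mem_univ f
  obtain ⟨u, hu, hd⟩ := Metric.mem_closure_iff.1 hf ε hε
  refine ⟨_, hu, fun ω => ?_⟩
  rw [← Real.dist_eq, dist_comm]
  exact (ContinuousMap.dist_apply_le_dist _).trans hd.le

/-! ### From the uniform span back to series of formulas -/

/-- A `[0,1]`-valued function in the uniform span is a uniform limit of functions in `R`. -/
theorem exists_near (hR : ConnectiveClosed R) {f : Ω → ℝ} (hf : f ∈ uniformSpan R)
    (h01 : ∀ ω, f ω ∈ Icc (0 : ℝ) 1) {ε : ℝ} (hε : 0 < ε) :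
    ∃ φ ∈ R, ∀ ω, |φ ω - f ω| ≤ ε := by
  obtain ⟨f', ⟨N, φ, hφ, h⟩, h1⟩ := hf ε hε
  -- With f' = 2^N (2φ - 1), this is f' truncated to `[0,1]`. Truncation is 1-Lipschitz and fixes
  -- `f`, so the error does not grow.
  refine ⟨_, hR.double (hR.tsub _ hφ _ (hR.half _ hR.one)) (N + 1), fun ω => ?_⟩
  have h2 : (2 : ℝ) ^ (N + 1) * max (φ ω - 1 / 2) 0 = max (f' ω) 0 := by
    rw [h]
    have hp : (0 : ℝ) < 2 ^ N := by positivity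
    rcases le_total (1 / 2) (φ ω) with h' | h'
    · rw [max_eq_left (by linarith), max_eq_left (mul_nonneg hp.le (by linarith)), pow_succ]
      ring
    · rw [max_eq_right (by linarith),
        max_eq_right (mul_nonpos_of_nonneg_of_nonpos hp.le (by linarith)), mul_zero]
  rw [h2]
  have h3 : f ω = min (max (f ω) 0) 1 := by
    rw [max_eq_left (h01 ω).1, min_eq_left (h01 ω).2]
  conv_lhs => rw [h3]
  have h4 : |max (f' ω) 0 - max (f ω) 0| ≤ ε :=
    (abs_max_sub_max_le_abs _ _ _).trans (h1 ω)
  refine (abs_min_sub_min_le_max _ _ _ _).trans (max_le h4 ?_)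
  simpa using hε.le

/-- One step of the expansion of a function as a series `∑ 2 ^ (-(n + 1)) ψ_n`. -/
theorem exists_digit (hR : ConnectiveClosed R) {f : Ω → ℝ} (hf : f ∈ uniformSpan R)
    (h01 : ∀ ω, f ω ∈ Icc (0 : ℝ) 1) :
    ∃ ψ ∈ R, (fun ω => 2 * f ω - ψ ω) ∈ uniformSpan R ∧
      ∀ ω, 2 * f ω - ψ ω ∈ Icc (0 : ℝ) 1 := by
  -- With error 1/4, the number 2(θ - 1/4) lies between 2f - 1 and 2f. Truncating it to `[0,1]`
  -- keeps it there, so the remainder 2f - ψ is again in `[0,1]`.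
  obtain ⟨θ, hθ, h⟩ := hR.exists_near hf h01 (ε := 1 / 4) (by norm_num)
  have hψ := hR.double (hR.tsub _ hθ _ (hR.half _ (hR.half _ hR.one))) 1
  refine ⟨_, hψ, ?_, fun ω => ?_⟩
  · simpa [sub_eq_add_neg] using
      hR.add_mem (hR.smul_mem hf 2) (hR.neg_mem (hR.subset_uniformSpan hψ))
  · have h1 := abs_le.1 (h ω)
    have h2 := h01 ω
    have h3 := hR.mem_Icc _ hθ ω
    simp only [Set.mem_Icc] at h2 h3 ⊢
    rcases le_total (θ ω) (1 / 4) with h4 | h4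
    · rw [max_eq_right (by linarith), mul_zero, min_eq_left zero_le_one]
      constructor <;> linarith
    · rw [max_eq_left (by linarith)]
      rcases le_total (2 ^ 1 * (θ ω - 1 / 2 / 2)) 1 with h5 | h5
      · rw [min_eq_left h5]
        constructor <;> linarith
      · rw [min_eq_right h5]
        constructor <;> linarith

/-- Iterating `exists_digit` on the remainders is a binary expansion: after n digits the error is
2^(-n) times a remainder in `[0,1]`. The series equals `f` exactly, as the definition of a formula
demands. -/
theorem exists_series (hR : ConnectiveClosed R) {f : Ω → ℝ} (hf : f ∈ uniformSpan R)
    (h01 : ∀ ω, f ω ∈ Icc (0 : ℝ) 1) :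
    ∃ ψ : ℕ → Ω → ℝ, (∀ m, ψ m ∈ R) ∧
      ∀ ω, ∑' m : ℕ, (1 / 2 : ℝ) ^ (m + 1) * ψ m ω = f ω := by
  let T := {f : Ω → ℝ // f ∈ uniformSpan R ∧ ∀ ω, f ω ∈ Icc (0 : ℝ) 1}
  choose d hdR hd hd01 using fun t : T => hR.exists_digit t.2.1 t.2.2
  let s : ℕ → T := fun n => Nat.rec ⟨f, hf, h01⟩ (fun _ t => ⟨_, hd t, hd01 t⟩) n
  have hs : ∀ n ω, (s (n + 1)).1 ω = 2 * (s n).1 ω - d (s n) ω := fun _ _ => rfl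
  refine ⟨fun m => d (s m), fun m => hdR _, fun ω => HasSum.tsum_eq ?_⟩
  have hsum : ∀ n, ∑ m ∈ Finset.range n, (1 / 2 : ℝ) ^ (m + 1) * d (s m) ω
      = f ω - (1 / 2 : ℝ) ^ n * (s n).1 ω := fun n => by
    induction n with
    | zero => simp [s]
    | succ n ih =>
      rw [Finset.sum_range_succ, ih, hs, pow_succ]
      ring
  refine ((summable_half_pow_mul fun m => hR.mem_Icc _ (hdR (s m)) ω).hasSum_iff_tendsto_nat).2 ?_
  have h0 : Filter.Tendsto (fun n => (1 / 2 : ℝ) ^ n * (s n).1 ω) Filter.atTop (nhds 0) := by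
    refine squeeze_zero (fun n => mul_nonneg (by positivity) ((s n).2.2 ω).1)
      (fun n => mul_le_of_le_one_right (by positivity) ((s n).2.2 ω).2) ?_
    exact tendsto_pow_atTop_nhds_zero_of_lt_one (by norm_num) (by norm_num)
  refine Filter.Tendsto.congr (fun n => (hsum n).symm) ?_
  simpa using tendsto_const_nhds.sub h0

end ConnectiveClosed

/-! ### Uniformly definable functions -/

variable {L : MetricSignature.{u, v}} {K : Type k}

/-- The value of a variable `x` which is known to be of sort `s`. -/
def Assignment.get {A : MetricStructure.{u, v, w} L} {n : ℕ} {Γ : Fin n → L.Srt}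
    (a : Assignment A Γ) {s : L.Srt} (x : Fin n) (h : Γ x = s) : A.carrier s :=
  h ▸ a x

/-- The functions given by restricted formulas in the members of a family of structures. -/
def restrictedValues (F : K → MetricStructure.{u, v, w} L) {n : ℕ} (Γ : Fin n → L.Srt) :
    Set ((Σ i, Assignment (F i) Γ) → ℝ) :=
  range fun (φ : RFormula L Γ) ω => φ.eval (F ω.1) ω.2

theorem restrictedValues_connectiveClosed (F : K → MetricStructure.{u, v, w} L) {n : ℕ}
    (Γ : Fin n → L.Srt) : ConnectiveClosed (restrictedValues F Γ) where
  mem_Icc := by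
    rintro _ ⟨φ, rfl⟩ ω
    exact φ.eval_mem _ _
  zero := ⟨.zero, rfl⟩
  one := ⟨.one, rfl⟩
  half := by
    rintro _ ⟨φ, rfl⟩
    exact ⟨.half φ, rfl⟩
  tsub := by
    rintro _ ⟨φ, rfl⟩ _ ⟨ψ, rfl⟩
    exact ⟨.tsub φ ψ, rfl⟩

/-- A real-valued function of the variables in the context `Γ`, given in each member of the family
`F`, is uniformly definable if it is in the uniform span of the restricted formulas. -/
def UniformlyDefinable (F : K → MetricStructure.{u, v, w} L) {n : ℕ} (Γ : Fin n → L.Srt)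
    (f : ∀ i, Assignment (F i) Γ → ℝ) : Prop :=
  (fun ω : Σ i, Assignment (F i) Γ => f ω.1 ω.2) ∈ uniformSpan (restrictedValues F Γ)

namespace UniformlyDefinable

variable {F : K → MetricStructure.{u, v, w} L} {n : ℕ} {Γ : Fin n → L.Srt}

/-- One formula serves all structures because the approximation takes place on the disjoint union of
their assignment spaces. -/
theorem exists_formula {f : ∀ i, Assignment (F i) Γ → ℝ} (hf : UniformlyDefinable F Γ f)
    (h01 : ∀ i a, f i a ∈ Icc (0 : ℝ) 1) :
    ∃ φ : Formula L Γ, ∀ i a, φ.eval (F i) a = f i a := by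
  obtain ⟨ψ, hψ, h⟩ := (restrictedValues_connectiveClosed F Γ).exists_series hf fun ω => h01 _ _
  choose φ hφ using hψ
  refine ⟨⟨φ⟩, fun i a => ?_⟩
  rw [← h ⟨i, a⟩]
  simp only [← hφ]
  rfl

theorem rel (P : L.Pred) (x : Fin (L.arity P) → Fin n) (h : ∀ j, Γ (x j) = L.dom P j) :
    UniformlyDefinable F Γ fun i a => (F i).interp P fun j => a.get (x j) (h j) :=
  (restrictedValues_connectiveClosed F Γ).subset_uniformSpan ⟨.rel P x h, rfl⟩

theorem add {f g : ∀ i, Assignment (F i) Γ → ℝ} (hf : UniformlyDefinable F Γ f)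
    (hg : UniformlyDefinable F Γ g) : UniformlyDefinable F Γ fun i a => f i a + g i a :=
  (restrictedValues_connectiveClosed F Γ).add_mem hf hg

theorem smul {f : ∀ i, Assignment (F i) Γ → ℝ} (hf : UniformlyDefinable F Γ f) (c : ℝ) :
    UniformlyDefinable F Γ fun i a => c * f i a :=
  (restrictedValues_connectiveClosed F Γ).smul_mem hf c

theorem const (c : ℝ) : UniformlyDefinable F Γ fun _ _ => c :=
  (restrictedValues_connectiveClosed F Γ).const_mem c

theorem clamp {f : ∀ i, Assignment (F i) Γ → ℝ} (hf : UniformlyDefinable F Γ f) :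
    UniformlyDefinable F Γ fun i a => (ContLogic.clamp (f i a) : ℝ) := by
  have hR := restrictedValues_connectiveClosed F Γ
  exact hR.max_mem_uniformSpan (hR.const_mem 0) (hR.min_mem_uniformSpan (hR.const_mem 1) hf)

theorem comp {M : Type*} [TopologicalSpace M] [CompactSpace M]
    (g : ∀ i, Assignment (F i) Γ → M)
    (hsep : ∀ p q : M, p ≠ q →
      ∃ u : C(M, ℝ), UniformlyDefinable F Γ (fun i a => u (g i a)) ∧ u p ≠ u q)
    (f : C(M, ℝ)) : UniformlyDefinable F Γ fun i a => f (g i a) :=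
  (restrictedValues_connectiveClosed F Γ).comp_mem_uniformSpan (fun ω => g ω.1 ω.2) hsep f

/-- The infimum is 1-Lipschitz for uniform distance and commutes with the increasing affine map c ↦
2^N (2c - 1), so quantifying the approximants approximates the infimum. -/
theorem iInf {s : L.Srt} {f : ∀ i, Assignment (F i) (Fin.cons s Γ : Fin (n + 1) → L.Srt) → ℝ}
    (hf : UniformlyDefinable F (Fin.cons s Γ : Fin (n + 1) → L.Srt) f) :
    UniformlyDefinable F Γ fun i a =>
      ⨅ y : (F i).carrier s, f i (Assignment.cons y a) := by
  intro ε hε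
  obtain ⟨B, -, hB⟩ := (restrictedValues_connectiveClosed F _).bounded hf
  obtain ⟨g, ⟨N, _, ⟨φ, rfl⟩, h⟩, hg⟩ := hf ε hε
  have hp : (0 : ℝ) ≤ 2 ^ N := by positivity
  have hbdd : ∀ i a, BddBelow (range fun y : (F i).carrier s => φ.eval (F i) (.cons y a)) :=
    fun i a => ⟨0, by rintro _ ⟨y, rfl⟩; exact (φ.eval_mem _ _).1⟩
  refine ⟨_, ⟨N, _, ⟨.inf s φ, rfl⟩, fun ω => rfl⟩, ?_⟩
  rintro ⟨i, a⟩
  have key : (2 : ℝ) ^ N * (2 * (⨅ y : (F i).carrier s, φ.eval (F i) (.cons y a)) - 1)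
      = ⨅ y : (F i).carrier s, (2 : ℝ) ^ N * (2 * φ.eval (F i) (.cons y a) - 1) := by
    have hmono : Monotone fun c : ℝ => (2 : ℝ) ^ N * (2 * c - 1) := fun c d hcd => by
      dsimp only
      gcongr
    exact hmono.map_ciInf_of_continuousAt (by fun_prop) (hbdd i a)
  change |(2 : ℝ) ^ N * (2 * (⨅ y : (F i).carrier s, φ.eval (F i) (.cons y a)) - 1) - _| ≤ ε
  rw [key]
  refine abs_ciInf_sub_le ⟨-2 ^ N, ?_⟩ ⟨-B, ?_⟩ fun y => ?_
  · rintro _ ⟨y, rfl⟩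
    have := (φ.eval_mem (F i) (.cons y a)).1
    nlinarith
  · rintro _ ⟨y, rfl⟩
    exact (abs_le.1 (hB ⟨i, .cons y a⟩)).1
  · exact (h ⟨i, .cons y a⟩) ▸ hg ⟨i, .cons y a⟩

end UniformlyDefinable

/-! ### Definability in one and two variables -/

/-- A function of one variable of sort `s` which is uniformly definable, whatever the context of
the variable. -/
def UniformlyDefinable₁ (F : K → MetricStructure.{u, v, w} L) (s : L.Srt)
    (f : ∀ i, (F i).carrier s → ℝ) : Prop :=
  ∀ ⦃n : ℕ⦄ (Γ : Fin n → L.Srt) (x : Fin n) (hx : Γ x = s),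
    UniformlyDefinable F Γ fun i a => f i (a.get x hx)

/-- A function of two variables of sorts `s` and `s'` which is uniformly definable, whatever the
context of the variables. -/
def UniformlyDefinable₂ (F : K → MetricStructure.{u, v, w} L) (s s' : L.Srt)
    (f : ∀ i, (F i).carrier s → (F i).carrier s' → ℝ) : Prop :=
  ∀ ⦃n : ℕ⦄ (Γ : Fin n → L.Srt) (x y : Fin n) (hx : Γ x = s) (hy : Γ y = s'),
    UniformlyDefinable F Γ fun i a => f i (a.get x hx) (a.get y hy)

theorem ciInf_dist_add_dist {Z : Type*} [MetricSpace Z] (p q : Z) :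
    ⨅ y, (dist p y + dist q y) = dist p q := by
  have : Nonempty Z := ⟨p⟩
  refine le_antisymm ?_ (le_ciInf fun y => dist_triangle_right p q y)
  exact (ciInf_le ⟨0, by rintro _ ⟨y, rfl⟩; positivity⟩ p).trans_eq (by simp [dist_comm])

/-- Maps between sorts are not terms of the language; only the predicates d(f z, y) are available.
The point y is eliminated by d(f z, g z') = inf_y (d(f z, y) + d(g z', y)). -/
theorem UniformlyDefinable₂.dist_dist {F : K → MetricStructure.{u, v, w} L} {s s' t : L.Srt}
    {f : ∀ i, (F i).carrier s → (F i).carrier t} {g : ∀ i, (F i).carrier s' → (F i).carrier t}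
    (hf : UniformlyDefinable₂ F s t fun i z y => dist (f i z) y)
    (hg : UniformlyDefinable₂ F s' t fun i z y => dist (g i z) y) :
    UniformlyDefinable₂ F s s' fun i z z' => dist (f i z) (g i z') := by
  intro n Γ x y hx hy
  have h := ((hf (Fin.cons t Γ : Fin (n + 1) → L.Srt) x.succ 0 hx rfl).add
    (hg (Fin.cons t Γ : Fin (n + 1) → L.Srt) y.succ 0 hy rfl)).iInf
  have he : ∀ i (a : Assignment (F i) Γ), dist (f i (a.get x hx)) (g i (a.get y hy)) =
      ⨅ y' : (F i).carrier t, (dist (f i (a.get x hx)) y' + dist (g i (a.get y hy)) y') :=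
    fun i a => (ciInf_dist_add_dist _ _).symm
  simp only [he]
  exact h

theorem UniformlyDefinable₂.iInf_add {F : K → MetricStructure.{u, v, w} L} {s t : L.Srt}
    {f : ∀ i, (F i).carrier s → (F i).carrier t → ℝ} {g : ∀ i, (F i).carrier s → ℝ}
    (hf : UniformlyDefinable₂ F s t f) (hg : UniformlyDefinable₁ F s g) :
    UniformlyDefinable₁ F t fun i y => ⨅ z, (f i z y + g i z) := fun n Γ x hx =>
  ((hf (Fin.cons s Γ : Fin (n + 1) → L.Srt) 0 x.succ rfl hx).add
    (hg (Fin.cons s Γ : Fin (n + 1) → L.Srt) 0 rfl)).iInf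

/-! ### Maps from `ω`-products to the Hilbert cube -/

/-- The map to the Hilbert cube with the coordinates `min (c * d (z 0, z (n + 1))) 1`. -/
def cubeMap (c : ℝ) {Z : Type w} [MetricSpace Z] (z : OmegaProd fun _ : ℕ => Z) :
    ℕ → unitInterval :=
  fun n => clamp (c * dist (z 0) (z (n + 1)))

/-- The map `π` into sequences is kept abstract because the ω-product sort gets a new name after
each further expansion. -/
theorem UniformlyDefinable₁.cubeMap {F : K → MetricStructure.{u, v, w} L} {s s' : L.Srt}
    {π : ∀ i, (F i).carrier s → OmegaProd fun _ : ℕ => (F i).carrier s'}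
    (hπ : ∀ j, UniformlyDefinable₂ F s s' fun i z y => dist (π i z j) y) (c : ℝ) (j : ℕ) :
    UniformlyDefinable₁ F s fun i z => (ContLogic.cubeMap c (π i z) j : ℝ) := fun _ Γ x hx =>
  ((((hπ 0).dist_dist (hπ (j + 1))) Γ x x hx hx).smul c).clamp

theorem UniformlyDefinable.comp_cube {F : K → MetricStructure.{u, v, w} L} {n : ℕ}
    {Γ : Fin n → L.Srt} {g : ∀ i, Assignment (F i) Γ → ℕ → unitInterval}
    (hg : ∀ j, UniformlyDefinable F Γ fun i a => (g i a j : ℝ)) (f : C(ℕ → unitInterval, ℝ)) :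
    UniformlyDefinable F Γ fun i a => f (g i a) := by
  refine UniformlyDefinable.comp g (fun p q hpq => ?_) f
  obtain ⟨j, hj⟩ := Function.ne_iff.1 hpq
  exact ⟨⟨fun p => (p j : ℝ), by fun_prop⟩, hg j, fun h => hj (Subtype.ext h)⟩

theorem UniformlyDefinable.comp_cube₂ {F : K → MetricStructure.{u, v, w} L} {n : ℕ}
    {Γ : Fin n → L.Srt} {g h : ∀ i, Assignment (F i) Γ → ℕ → unitInterval}
    (hg : ∀ j, UniformlyDefinable F Γ fun i a => (g i a j : ℝ))
    (hh : ∀ j, UniformlyDefinable F Γ fun i a => (h i a j : ℝ))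
    (f : C((ℕ → unitInterval) × (ℕ → unitInterval), ℝ)) :
    UniformlyDefinable F Γ fun i a => f (g i a, h i a) := by
  refine UniformlyDefinable.comp (fun i a => (g i a, h i a)) (fun p q hpq => ?_) f
  by_cases h1 : p.1 = q.1
  · obtain ⟨j, hj⟩ := Function.ne_iff.1 fun h2 => hpq (Prod.ext h1 h2)
    exact ⟨⟨fun p => (p.2 j : ℝ), by fun_prop⟩, hh j, fun h => hj (Subtype.ext h)⟩
  · obtain ⟨j, hj⟩ := Function.ne_iff.1 h1
    exact ⟨⟨fun p => (p.1 j : ℝ), by fun_prop⟩, hg j, fun h => hj (Subtype.ext h)⟩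

theorem UniformlyDefinable₁.comp_cubeMap {F : K → MetricStructure.{u, v, w} L} {s s' : L.Srt}
    {π : ∀ i, (F i).carrier s → OmegaProd fun _ : ℕ => (F i).carrier s'}
    (hπ : ∀ j, UniformlyDefinable₂ F s s' fun i z y => dist (π i z j) y) (c : ℝ)
    (f : C(ℕ → unitInterval, ℝ)) :
    UniformlyDefinable₁ F s fun i z => f (ContLogic.cubeMap c (π i z)) := fun _ Γ x hx =>
  .comp_cube (fun j => UniformlyDefinable₁.cubeMap hπ c j Γ x hx) f

theorem UniformlyDefinable₂.comp_cubeMap {F : K → MetricStructure.{u, v, w} L} {s s' : L.Srt}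
    {π : ∀ i, (F i).carrier s → OmegaProd fun _ : ℕ => (F i).carrier s'}
    (hπ : ∀ j, UniformlyDefinable₂ F s s' fun i z y => dist (π i z j) y) (c : ℝ)
    (f : C((ℕ → unitInterval) × (ℕ → unitInterval), ℝ)) :
    UniformlyDefinable₂ F s s fun i z z' =>
      f (ContLogic.cubeMap c (π i z), ContLogic.cubeMap c (π i z')) := fun _ Γ x y hx hy =>
  .comp_cube₂ (fun j => UniformlyDefinable₁.cubeMap hπ c j Γ x hx)
    (fun j => UniformlyDefinable₁.cubeMap hπ c j Γ y hy) f

/-! ### The predicates of imaginary expansions -/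

section Steps

variable {F : K → MetricStructure.{u, v, w} L}

theorem omegaProd_proj_definable (O : ℕ → L.Srt) (j : ℕ) :
    UniformlyDefinable₂ (ImaginaryStep.omegaProd (F := F) O).str none (some (O j))
      fun i (z : OmegaProd fun j => (F i).carrier (O j)) (y : (F i).carrier (O j)) =>
        dist (z j) y := fun _ _ x y hx hy =>
  UniformlyDefinable.rel (F := (ImaginaryStep.omegaProd (F := F) O).str) (Sum.inr j) ![x, y]
    (Fin.cons hx (Fin.cons hy fun l => l.elim0))

theorem quotient_mk_definable (O : L.Srt) (ρ : Formula L ![O, O])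
    (h : ∀ i, IsPseudoMetric (ρ.eval₂ (F i))) :
    UniformlyDefinable₂ (ImaginaryStep.quotient O ρ h).str (some O) none
      fun i (z : (F i).carrier O) (y : PseudoQuot (ρ.eval₂ (F i)) (h i)) =>
        dist (PseudoQuot.mk _ (h i) z) y := fun _ _ x y hx hy =>
  UniformlyDefinable.rel (F := (ImaginaryStep.quotient O ρ h).str) (Sum.inr ()) ![x, y]
    (Fin.cons hx (Fin.cons hy fun l => l.elim0))

theorem defSet_incl_definable (O : L.Srt) (φ : Formula L ![O])
    (h : ∀ i, IsDistancePredicate φ (F i)) :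
    UniformlyDefinable₂ (ImaginaryStep.defSet O φ h).str none (some O)
      fun i (z : DefinableSet φ (F i)) (y : (F i).carrier O) => dist z.1 y :=
  fun _ _ x y hx hy =>
  UniformlyDefinable.rel (F := (ImaginaryStep.defSet O φ h).str) (Sum.inr ()) ![x, y]
    (Fin.cons hx (Fin.cons hy fun l => l.elim0))

/-- The projections survive later steps: each expansion wraps old sorts in `some` and old predicates
in `Sum.inl`. -/
theorem quotient_omegaProd_proj_definable (O : ℕ → L.Srt) (s : Option L.Srt)
    (ρ : Formula (ImaginaryStep.omegaProd (F := F) O).sig ![s, s])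
    (h : ∀ i, IsPseudoMetric (ρ.eval₂ ((ImaginaryStep.omegaProd (F := F) O).str i))) (j : ℕ) :
    UniformlyDefinable₂ (ImaginaryStep.quotient (F := (ImaginaryStep.omegaProd (F := F) O).str)
        s ρ h).str (some none) (some (some (O j)))
      fun i (z : OmegaProd fun j => (F i).carrier (O j)) (y : (F i).carrier (O j)) =>
        dist (z j) y := fun _ _ x y hx hy =>
  UniformlyDefinable.rel (F := (ImaginaryStep.quotient
    (F := (ImaginaryStep.omegaProd (F := F) O).str) s ρ h).str)
    (Sum.inl (Sum.inr j)) ![x, y] (Fin.cons hx (Fin.cons hy fun l => l.elim0))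

theorem defSet_quotient_mk_definable (O : L.Srt) (ρ : Formula L ![O, O])
    (h : ∀ i, IsPseudoMetric (ρ.eval₂ (F i))) (s : Option L.Srt)
    (φ : Formula (ImaginaryStep.quotient (F := F) O ρ h).sig ![s])
    (h' : ∀ i, IsDistancePredicate φ ((ImaginaryStep.quotient (F := F) O ρ h).str i)) :
    UniformlyDefinable₂ (ImaginaryStep.defSet
        (F := (ImaginaryStep.quotient (F := F) O ρ h).str) s φ h').str (some (some O)) (some none)
      fun i (z : (F i).carrier O) (y : PseudoQuot (ρ.eval₂ (F i)) (h i)) =>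
        dist (PseudoQuot.mk _ (h i) z) y := fun _ _ x y hx hy =>
  UniformlyDefinable.rel (F := (ImaginaryStep.defSet
        (F := (ImaginaryStep.quotient (F := F) O ρ h).str) s φ h').str)
    (Sum.inl (Sum.inr ())) ![x, y] (Fin.cons hx (Fin.cons hy fun l => l.elim0))

theorem defSet_quotient_omegaProd_proj_definable (O : ℕ → L.Srt) (s : Option L.Srt)
    (ρ : Formula (ImaginaryStep.omegaProd (F := F) O).sig ![s, s])
    (h : ∀ i, IsPseudoMetric (ρ.eval₂ ((ImaginaryStep.omegaProd (F := F) O).str i)))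
    (s' : Option (Option L.Srt)) (φ : Formula (ImaginaryStep.quotient
      (F := (ImaginaryStep.omegaProd (F := F) O).str) s ρ h).sig ![s'])
    (h' : ∀ i, IsDistancePredicate φ ((ImaginaryStep.quotient
      (F := (ImaginaryStep.omegaProd (F := F) O).str) s ρ h).str i)) (j : ℕ) :
    UniformlyDefinable₂ (ImaginaryStep.defSet
        (F := (ImaginaryStep.quotient
          (F := (ImaginaryStep.omegaProd (F := F) O).str) s ρ h).str) s' φ h').str
      (some (some none)) (some (some (some (O j))))
      fun i (z : OmegaProd fun j => (F i).carrier (O j)) (y : (F i).carrier (O j)) =>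
        dist (z j) y := fun _ _ x y hx hy =>
  UniformlyDefinable.rel (F := (ImaginaryStep.defSet
        (F := (ImaginaryStep.quotient
          (F := (ImaginaryStep.omegaProd (F := F) O).str) s ρ h).str) s' φ h').str)
    (Sum.inl (Sum.inl (Sum.inr j))) ![x, y] (Fin.cons hx (Fin.cons hy fun l => l.elim0))

end Steps

/-! ### Isometric copies in quotients -/

section Metric

variable {P Q W X : Type*} [MetricSpace Q] [MetricSpace W]

/-- Here `m` is the quotient map and `t` the map to the fixed space. The infimum is attained at
`z₀`, which enters the right side only through `t z₀`; so no parameter from the structure is needed.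
The point `y` may be one added by completion. -/
theorem dist_eq_ciInf {m : P → Q} {t : P → W}
    (hm : ∀ z z', dist (m z) (m z') = dist (t z) (t z')) (y : Q) (z₀ : P) :
    dist y (m z₀) = ⨅ z, (dist (m z) y + dist (t z) (t z₀)) := by
  have : Nonempty P := ⟨z₀⟩
  refine le_antisymm (le_ciInf fun z => ?_) ?_
  · rw [← hm, dist_comm (m z) y]
    exact dist_triangle _ _ _
  · exact (ciInf_le ⟨0, by rintro _ ⟨y, rfl⟩; positivity⟩ z₀).trans_eq (by simp [dist_comm])

theorem infDist_eq_ciInf [Nonempty X] {m : P → Q} {t : P → W}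
    (hm : ∀ z z', dist (m z) (m z') = dist (t z) (t z')) (y : Q) (z : X → P) :
    Metric.infDist y (range fun p => m (z p)) =
      ⨅ a, (dist (m a) y + Metric.infDist (t a) (range fun p => t (z p))) := by
  have : Nonempty P := ‹Nonempty X›.map z
  refine le_antisymm (le_ciInf fun a => ?_) ?_
  · refine (Metric.infDist_le_infDist_add_dist (y := m a)).trans ?_
    rw [add_comm, dist_comm]
    gcongr
    refine (Metric.le_infDist (range_nonempty _)).2 ?_
    rintro _ ⟨p, rfl⟩
    rw [← hm]
    exact Metric.infDist_le_dist_of_mem ⟨p, rfl⟩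
  · refine (Metric.le_infDist (range_nonempty _)).2 ?_
    rintro _ ⟨p, rfl⟩
    refine (ciInf_le ⟨0, ?_⟩ (z p)).trans_eq ?_
    · rintro _ ⟨a, rfl⟩
      exact add_nonneg dist_nonneg Metric.infDist_nonneg
    · dsimp only
      rw [Metric.infDist_zero_of_mem (s := range fun p => t (z p)) ⟨p, rfl⟩, add_zero, dist_comm]

end Metric

/-! ### Compact metric spaces as images of the Cantor space -/

/-- The inclusion of the Cantor space in the Hilbert cube. -/
def cantorCube (b : ℕ → Bool) : ℕ → unitInterval := fun n => if b n then 1 else 0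

theorem continuous_cantorCube : Continuous cantorCube :=
  continuous_pi fun n => (continuous_of_discreteTopology (f := fun c : Bool =>
    (if c then 1 else 0 : unitInterval))).comp (continuous_apply n)

theorem cantorCube_injective : Function.Injective cantorCube := by
  intro b b' h
  funext n
  have := congrFun h n
  unfold cantorCube at this
  cases hb : b n <;> cases hb' : b' n <;> simp_all

/-- The Kuratowski embedding. -/
def kuratowski (X : Type x) [MetricSpace X] [CompactSpace X] (p : X) : C(X, ℝ) :=
  ⟨fun q => dist p q, by fun_prop⟩

theorem isometry_kuratowski (X : Type x) [MetricSpace X] [CompactSpace X] :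
    Isometry (kuratowski X) := by
  refine Isometry.of_dist_eq fun p q => le_antisymm ?_ ?_
  · refine (ContinuousMap.dist_le dist_nonneg).2 fun y => ?_
    exact abs_dist_sub_le p q y
  · refine le_trans ?_ (ContinuousMap.dist_apply_le_dist (f := kuratowski X p)
      (g := kuratowski X q) q)
    simp [kuratowski]

/-- Tietze is applied to the real function d(h b, y) on the closed copy of Cantor space × `X` in
cube × `X`, and the extension is curried. Keeping its values in `[0,1]` bounds the distances by 1.
-/
theorem exists_cube_extension (X : Type x) [MetricSpace X] [CompactSpace X] [Nonempty X]
    (hX : ∀ p q : X, dist p q ≤ 1) :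
    ∃ M : C(ℕ → unitInterval, C(X, ℝ)), (∀ s s', dist (M s) (M s') ≤ 1) ∧
      ∀ p, ∃ b : ℕ → Bool, M (cantorCube b) = kuratowski X p := by
  obtain ⟨h, hc, hs⟩ := exists_nat_bool_continuous_surjective_of_compact X
  let j : (ℕ → Bool) × X → (ℕ → unitInterval) × X := Prod.map cantorCube id
  have hj : Topology.IsClosedEmbedding j :=
    (continuous_cantorCube.prodMap continuous_id).isClosedEmbedding
      (cantorCube_injective.prodMap Function.injective_id)
  obtain ⟨G, hG, hGj⟩ := BoundedContinuousFunction.exists_extension_forall_mem_Icc_of_isClosedEmbedding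
    (BoundedContinuousFunction.mkOfCompact
      (⟨fun a => dist (h a.1) a.2, by fun_prop⟩ : C((ℕ → Bool) × X, ℝ)))
    (a := 0) (b := 1) (fun a => ⟨dist_nonneg, hX _ _⟩) zero_le_one hj
  refine ⟨G.toContinuousMap.curry, fun s s' => ?_, fun p => ?_⟩
  · refine (ContinuousMap.dist_le zero_le_one).2 fun y => ?_
    exact abs_sub_le_one (hG (s, y)) (hG (s', y))
  · obtain ⟨b, rfl⟩ := hs p
    exact ⟨b, ContinuousMap.ext fun y => congrFun hGj (b, y)⟩

/-- The diameter need not be attained, so only a pair at distance at least r/2 is available; the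
factor 2/r brings that distance up to 1, where truncation makes it exactly 1. -/
theorem exists_cubeMap_eq {Z : Type w} [MetricSpace Z] {r : ℝ} (hr : 0 < r)
    (hZ : r ≤ Metric.diam (univ : Set Z)) (b : ℕ → Bool) :
    ∃ z : OmegaProd fun _ : ℕ => Z, cubeMap (2 / r) z = cantorCube b := by
  obtain ⟨p, q, hpq⟩ : ∃ p q : Z, r / 2 ≤ dist p q := by
    by_contra! hcon
    have := Metric.diam_le_of_forall_dist_le (s := (univ : Set Z)) (half_pos hr).le
      fun p _ q _ => (hcon p q).le
    linarith
  -- Entry 0 is the base point `p`; entry n + 1 encodes the bit `b n`.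
  refine ⟨fun n => Nat.casesOn n p fun m => if b m then q else p, funext fun n => ?_⟩
  change clamp (2 / r * dist p (if b n then q else p)) = if b n then 1 else 0
  cases b n with
  | false => simp [clamp]
  | true =>
    refine projIcc_of_right_le _ ?_
    calc (1 : ℝ) = 2 / r * (r / 2) := by field_simp
      _ ≤ _ := by simpa using mul_le_mul_of_nonneg_left hpq (by positivity : 0 ≤ 2 / r)

/-! ### The compact metric space as a sort -/

section Expansion

variable (F : K → MetricStructure.{u, v, w} L) (H : L.Srt) {W : Type x} [MetricSpace W]

theorem exists_cubeMap_pseudoMetric (c : ℝ) (M : C(ℕ → unitInterval, W))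
    (hM : ∀ s s', dist (M s) (M s') ≤ 1) :
    ∃ ρ : Formula (ImaginaryStep.omegaProd (F := F) fun _ => H).sig ![none, none],
      ∀ i (z z' : OmegaProd fun _ : ℕ => (F i).carrier H),
        ρ.eval₂ ((ImaginaryStep.omegaProd (F := F) fun _ => H).str i) z z' =
          dist (M (cubeMap c z)) (M (cubeMap c z')) := by
  have h := UniformlyDefinable₂.comp_cubeMap
    (F := (ImaginaryStep.omegaProd (F := F) fun _ => H).str) (s := none) (s' := some H)
    (π := fun i (z : OmegaProd fun _ : ℕ => (F i).carrier H) => z)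
    (omegaProd_proj_definable (F := F) fun _ => H) c
    ⟨fun s => dist (M s.1) (M s.2), by fun_prop⟩ ![none, none] 0 1 rfl rfl
  obtain ⟨ρ, hρ⟩ := h.exists_formula fun i a => ⟨dist_nonneg, hM _ _⟩
  exact ⟨ρ, fun i z z' => hρ i _⟩

/-- Three steps suffice: the ω-power of `H`, its quotient by the pseudo-metric pulled back from `W`,
and the copy of `κ(X)` as a definable set of the quotient. -/
theorem exists_expansion_of_cubeMap {X : Type x} [MetricSpace X] [CompactSpace X] [Nonempty X]
    (c : ℝ) (M : C(ℕ → unitInterval, W))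
    (hM : ∀ s s', dist (M s) (M s') ≤ 1) (κ : X → W) (hκ : Isometry κ)
    (hsurj : ∀ i p, ∃ z : OmegaProd fun _ : ℕ => (F i).carrier H, M (cubeMap c z) = κ p) :
    ∃ (E : ImaginaryExpansion F) (Y : E.sig.Srt) (e : (i : K) → X ≃ᵢ (E.str i).carrier Y),
      ∀ p : X, UniformlyDefinable₁ E.str Y fun i y => dist y (e i p) := by
  -- The choice of representatives is harmless: two preimages of the same `κ p` have pseudo-distance
  -- 0, hence the same class.
  choose z hz using hsurj
  obtain ⟨ρ, hρ⟩ := exists_cubeMap_pseudoMetric F H c M hM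
  have hps : ∀ i, IsPseudoMetric
      (ρ.eval₂ ((ImaginaryStep.omegaProd (F := F) fun _ => H).str i)) := fun i =>
    { self := fun a => (hρ i a a).trans (dist_self _)
      symm := fun a b => (hρ i a b).trans ((dist_comm _ _).trans (hρ i b a).symm)
      triangle := fun a b d => by
        rw [hρ i a b, hρ i b d, hρ i a d]
        exact dist_triangle _ _ _ }
  let S₂ := ImaginaryStep.quotient (F := (ImaginaryStep.omegaProd (F := F) fun _ => H).str)
    none ρ hps
  let m : ∀ i, (OmegaProd fun _ : ℕ => (F i).carrier H) → PseudoQuot _ (hps i) :=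
    fun i => PseudoQuot.mk _ (hps i)
  have hm : ∀ i a b, dist (m i a) (m i b) = dist (M (cubeMap c a)) (M (cubeMap c b)) :=
    fun i a b => (PseudoQuot.dist_mk _ (hps i) a b).trans (hρ i a b)
  let e₀ : ∀ i, X → PseudoQuot _ (hps i) := fun i p => m i (z i p)
  have he₀ : ∀ i, Isometry (e₀ i) := fun i => Isometry.of_dist_eq fun p q => by
    rw [hm, hz, hz, hκ.dist_eq]
  have hrange : ∀ i, (range fun p => M (cubeMap c (z i p))) = range κ := fun i => by
    simp only [hz]
  have hφ := (quotient_mk_definable (F := (ImaginaryStep.omegaProd (F := F) fun _ => H).str)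
      none ρ hps).iInf_add
    (UniformlyDefinable₁.comp_cubeMap (F := S₂.str) (s := some none) (s' := some (some H))
      (π := fun i (z : OmegaProd fun _ : ℕ => (F i).carrier H) => z)
      (quotient_omegaProd_proj_definable (F := F) (fun _ => H) none ρ hps) c
      ⟨fun s => Metric.infDist (M s) (range κ), by fun_prop⟩)
  have hφ' : UniformlyDefinable₁ S₂.str none fun i (y : PseudoQuot _ (hps i)) =>
      Metric.infDist y (range (e₀ i)) := by
    convert hφ using 4 with i y
    rw [infDist_eq_ciInf (hm i), hrange i]
    rfl
  obtain ⟨φ, hφe⟩ := (hφ' ![none] 0 rfl).exists_formula fun i a => by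
    obtain ⟨p⟩ := ‹Nonempty X›
    exact ⟨Metric.infDist_nonneg, (Metric.infDist_le_dist_of_mem (mem_range_self p)).trans
      ((S₂.str i).dist_le_one none _ _)⟩
  have hφD : ∀ i y, φ.eval₁ (S₂.str i) y = Metric.infDist y (range (e₀ i)) := fun i y => hφe i _
  have hdp : ∀ i, IsDistancePredicate φ (S₂.str i) := fun i =>
    ⟨range (e₀ i), range_nonempty _, hφD i⟩
  let S₃ := ImaginaryStep.defSet (F := S₂.str) none φ hdp
  -- Compactness of `X` makes the copy closed, so the zero set of its distance predicate contains no
  -- further points and the isometry is onto.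
  have hclosed : ∀ i, IsClosed (range (e₀ i)) := fun i =>
    (isCompact_range (he₀ i).continuous).isClosed
  have hmem : ∀ i y, φ.eval₁ (S₂.str i) y = 0 ↔ y ∈ range (e₀ i) := fun i y => by
    rw [hφD, (hclosed i).mem_iff_infDist_zero (range_nonempty _)]
  let e₁ : ∀ i, X → DefinableSet φ (S₂.str i) := fun i p => ⟨e₀ i p, (hmem i _).2 ⟨p, rfl⟩⟩
  have he₁ : ∀ i, Isometry (e₁ i) := fun i => Isometry.of_dist_eq fun p q => (he₀ i).dist_eq p q
  have hbij : ∀ i, Function.Bijective (e₁ i) := fun i => ⟨(he₁ i).injective, fun y => by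
    obtain ⟨p, hp⟩ := (hmem i _).1 y.2
    exact ⟨p, Subtype.ext hp⟩⟩
  refine ⟨.step _ (.step S₂ (.step S₃ (.refl _))), none,
    fun i => ⟨Equiv.ofBijective (e₁ i) (hbij i), he₁ i⟩, fun p => ?_⟩
  -- The quotient map and the inclusion are both given by predicates only, so the distance from [a]
  -- to the image of y is obtained by quantifying over the quotient sort.
  have h₃ := ((defSet_quotient_mk_definable (F := (ImaginaryStep.omegaProd (F := F)
      fun _ => H).str) none ρ hps none φ hdp).dist_dist
      (defSet_incl_definable (F := S₂.str) none φ hdp)).iInf_add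
    (UniformlyDefinable₁.comp_cubeMap (F := S₃.str) (s := some (some none))
      (s' := some (some (some H)))
      (π := fun i (z : OmegaProd fun _ : ℕ => (F i).carrier H) => z)
      (defSet_quotient_omegaProd_proj_definable (F := F) (fun _ => H) none ρ hps none φ hdp) c
      ⟨fun s => dist (M s) (κ p), by fun_prop⟩)
  have h₄ : ∀ i (y : DefinableSet φ (S₂.str i)), dist y (e₁ i p) =
      ⨅ a, (dist (m i a) y.1 + dist (M (cubeMap c a)) (κ p)) := fun i y => by
    rw [← hz i p]
    exact dist_eq_ciInf (hm i) y.1 (z i p)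
  have h₅ : UniformlyDefinable₁ S₃.str none fun i (y : DefinableSet φ (S₂.str i)) =>
      dist y (e₁ i p) := by
    simp only [h₄]
    exact h₃
  exact h₅

/-- If the distances from the points of an isometric copy of a compact space are uniformly
definable, then so are all continuous functions. -/
theorem exists_formula_of_continuous {Y : L.Srt} {X : Type x} [MetricSpace X] [CompactSpace X]
    (e : (i : K) → X ≃ᵢ (F i).carrier Y)
    (he : ∀ p : X, UniformlyDefinable₁ F Y fun i y => dist y (e i p)) (n : ℕ)
    (f : C(Fin n → X, unitInterval)) :
    ∃ φ : Formula L (fun _ : Fin n => Y), ∀ i (y : Fin n → (F i).carrier Y),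
      φ.eval (F i) y = (f (fun j => (e i).symm (y j)) : ℝ) := by
  have h := UniformlyDefinable.comp (F := F) (Γ := fun _ : Fin n => Y)
    (fun i a j => (e i).symm (a j)) (fun p q hpq => ?_)
    ⟨fun p => (f p : ℝ), by fun_prop⟩
  · exact h.exists_formula fun i a => (f _).2
  · obtain ⟨j, hj⟩ := Function.ne_iff.1 hpq
    -- The distance to `q j` in a coordinate where `p` and `q` differ vanishes at `q` but not at
    -- `p`.
    refine ⟨⟨fun a => dist (a j) (q j), by fun_prop⟩, ?_, by simpa using hj⟩
    convert he (q j) (fun _ : Fin n => Y) j rfl using 3 with i a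
    change dist ((e i).symm (a j)) (q j) = dist (a j) (e i (q j))
    rw [← (e i).dist_eq, (e i).apply_symm_apply]

end Expansion

end

end ContLogic

theorem lemma3p3 (L : ContLogic.MetricSignature.{u, v}) (H : L.Srt) (r : ℝ) (hr0 : 0 < r)
    (hr1 : r ≤ 1) (X : Type x) [MetricSpace X] [CompactSpace X] [Nonempty X]
    (hX : ∀ p q : X, dist p q ≤ 1) :
    ∃ (E : ContLogic.ImaginaryExpansion (ContLogic.StructureClass.family.{u, v, w} L H r))
      (Y : E.sig.Srt)
      (e : (A : ContLogic.StructureClass.{u, v, w} L H r) → X ≃ᵢ (E.str A).carrier Y),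
      (∀ p : X, ∃ φ : ContLogic.Formula E.sig ![Y],
        ∀ (A : ContLogic.StructureClass.{u, v, w} L H r) (y : (E.str A).carrier Y),
          φ.eval₁ (E.str A) y = dist y (e A p)) ∧
      (∀ (n : ℕ) (f : C(Fin n → X, unitInterval)),
        ∃ φ : ContLogic.Formula E.sig (fun _ : Fin n => Y),
          ∀ (A : ContLogic.StructureClass.{u, v, w} L H r) (y : Fin n → (E.str A).carrier Y),
            φ.eval (E.str A) y = (f (fun i => (e A).symm (y i)) : ℝ)) := by
  obtain ⟨M, hM, hsurj⟩ := ContLogic.exists_cube_extension X hX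
  obtain ⟨E, Y, e, he⟩ := ContLogic.exists_expansion_of_cubeMap
    (ContLogic.StructureClass.family.{u, v, w} L H r) H (2 / r) M hM (ContLogic.kuratowski X)
    (ContLogic.isometry_kuratowski X) fun A p => by
      obtain ⟨b, hb⟩ := hsurj p
      obtain ⟨z, hz⟩ := ContLogic.exists_cubeMap_eq hr0 A.2 b
      exact ⟨z, (congrArg M hz).trans hb⟩
  refine ⟨E, Y, e, fun p => ?_, ContLogic.exists_formula_of_continuous E.str e he⟩
  obtain ⟨φ, hφ⟩ := (he p ![Y] 0 rfl).exists_formula fun A a =>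
    ⟨dist_nonneg, (E.str A).dist_le_one Y _ _⟩
  exact ⟨φ, fun A y => hφ A _⟩
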